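/- Let $(X_1,m_1)$ and $(X_2,m_2)$ be nonempty $\sigma$-finite standard Borel measure spaces, and let $(T^{(1)}_t)_{t\ge 0}$, $(T^{(2)}_t)_{t\ge 0}$ be irreducible Markovian semigroups on $L^2(X_1,m_1)$, $L^2(X_2,m_2)$; that is, strongly continuous symmetric contraction semigroups of positivity preserving operators with $\widetilde{T^{(i)}_t}1\le 1$ for all $t\ge 0$, such that every measurable set $A\subseteq X_i$ with $\widetilde{T^{(i)}_t}\mathbf 1_A\le \mathbf 1_A$ for all $t\ge 0$ satisfies $m_i(A)=0$ or $m_i(A^c)=0$. Here $L_+(X,m)$ is the space of a.e. classes of measurable functions $X\to[0,\infty]$. For a positivity preserving operator $S$ from $L^p(X,m)$ to $L^p(Y,n)$, which for $p=\infty$ is assumed to be the adjoint of an operator from $L^1(Y,n)$ to $L^1(X,m)$, $\widetilde S\colon L_+(X,m)\to L_+(Y,n)$ denotes its unique extension such that $f_k\nearrow f$ implies $\widetilde S f_k\nearrow\widetilde S f$. For $1\le r<\infty$, the semigroup $(T^{(i)}_t)$ also acts on $L^r(X_i,m_i)$ by continuous extension from $L^2\cap L^r$, and on $L^\infty(X_i,m_i)$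 by the adjoints of the operators on $L^1(X_i,m_i)$. All $L^r$-spaces are real. An order isomorphism $U\colon L^r(X_1,m_1)\to L^r(X_2,m_2)$ is an invertible linear map such that $U$ and $U^{-1}$ are positivity preserving; it intertwines the semigroups if $UT^{(1)}_t=T^{(2)}_tU$ on $L^r(X_1,m_1)$ for all $t\ge 0$. A measurable $h\colon X_2\to(0,\infty)$ and a measurable $\tau\colon X_2\to X_1$ with measurable a.e. inverse are called a scaling and a transformation of $U$ if $Uf=h\cdot(f\circ\tau)$ a.e. for all $f\in L^r(X_1,m_1)$. Let $p\in[1,\infty)$, let $q$ be the dual exponent, and let $U\colon L^p(X_1,m_1)\to L^p(X_2,m_2)$ be an order isomorphism intertwining $(T^{(1)}_t)$ and $(T^{(2)}_t)$. Then $U$ has an adjoint $U^*\colon L^q(X_2,m_2)\to L^q(X_1,m_1)$ and a scaling $h$ and transformation $\tau$, and there is a constant $\beta>0$ such that $$\widetilde U\,\widetilde{U^*}g=\beta g\quad (g\in L_+(X_2,m_2)),\qquad \widetilde{U^*}\,\widetilde U f=\beta f\quad (f\in L_+(X_1,m_1)),$$ and, for every scaling $h$ and transformation $\tau$ of $U$,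 $$\tau_\#(h^2m_2)=\beta m_1 .$$ Moreover, if $p\ne 2$, then for every scaling $h$ and transformation $\tau$ of $U$, both $h$ and $h^{-1}$ are essentially bounded, and for every $r\in[1,\infty]$ the restriction $U|_{L^p\cap L^r}$ extends to an order isomorphism $U^{(r)}\colon L^r(X_1,m_1)\to L^r(X_2,m_2)$ intertwining $(T^{(1)}_t)$ and $(T^{(2)}_t)$ with the same scaling $h$ and transformation $\tau$. -/

import Mathlib

open MeasureTheory Filter Topology
open scoped ENNReal NNReal

noncomputable section

namespace OrderIntertwining

/-! ### Extension of positivity preserving operators to `[0, ∞]`-valued functions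

`X →ₘ[m] ℝ≥0∞` is the space of classes of measurable functions `X → [0, ∞]`. -/

section Extension

variable {X Y : Type*} [MeasurableSpace X] [MeasurableSpace Y]

/-- The function `min (f, n) 𝟙_{E n}`, where `E n` increases to `X` and has finite measure. -/
def truncFun (m : Measure X) [SigmaFinite m] (f : X →ₘ[m] ℝ≥0∞) (n : ℕ) : X → ℝ :=
  (spanningSets m n).indicator fun x => (min (f x) (n : ℝ≥0∞)).toReal

theorem memLp_truncFun (p : ℝ≥0∞) (m : Measure X) [SigmaFinite m] (f : X →ₘ[m] ℝ≥0∞) (n : ℕ) :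
    MemLp (truncFun m f n) p m := by
  have hmeas : AEStronglyMeasurable
      (fun x => (min (f x) (n : ℝ≥0∞)).toReal) m :=
    ((f.aemeasurable.min aemeasurable_const).ennreal_toReal).aestronglyMeasurable
  unfold truncFun
  rw [memLp_indicator_iff_restrict (measurableSet_spanningSets m n)]
  have : IsFiniteMeasure (m.restrict (spanningSets m n)) :=
    ⟨by simpa using measure_spanningSets_lt_top m n⟩
  refine MemLp.of_bound hmeas.restrict (n : ℝ) (Eventually.of_forall fun x => ?_)
  rw [Real.norm_of_nonneg ENNReal.toReal_nonneg]
  have h := ENNReal.toReal_mono (ENNReal.natCast_ne_top n) (min_le_right (f x) (n : ℝ≥0∞))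
  simpa using h

/-- The class of `min (f, n) 𝟙_{E n}` in `L^p`; these increase to `f` as `n → ∞`. -/
def trunc (p : ℝ≥0∞) (m : Measure X) [SigmaFinite m] (f : X →ₘ[m] ℝ≥0∞) (n : ℕ) : Lp ℝ p m :=
  (memLp_truncFun p m f n).toLp

/-- The extension `S̃ : L₊(X) → L₊(Y)` of a positivity preserving operator `S : L^p(X) → L^p(Y)`:
`S̃ f = sup_n S fₙ` for the sequence `fₙ = min (f, n) 𝟙_{E n}` in `L^p` increasing to `f`. -/
def posExt {p : ℝ≥0∞} {m : Measure X} [SigmaFinite m] {m' : Measure Y}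
    (S : Lp ℝ p m → Lp ℝ p m') (f : X →ₘ[m] ℝ≥0∞) : Y →ₘ[m'] ℝ≥0∞ :=
  AEEqFun.mk (fun y => ⨆ n : ℕ, ENNReal.ofReal (S (trunc p m f n) y))
    (AEMeasurable.iSup fun n =>
      (Lp.aestronglyMeasurable (S (trunc p m f n))).aemeasurable.ennreal_ofReal).aestronglyMeasurable

/-- The class of the indicator function of a measurable set in `L₊(X)`. -/
def indClass (m : Measure X) {A : Set X} (hA : MeasurableSet A) : X →ₘ[m] ℝ≥0∞ :=
  AEEqFun.mk (A.indicator 1) (measurable_one.indicator hA).aestronglyMeasurable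

end Extension

/-! ### Markovian semigroups -/

section Semigroup

variable {X : Type*} [MeasurableSpace X]

/-- A Markovian semigroup: a strongly continuous symmetric contraction semigroup of positivity
preserving operators on `L²(X, m)` such that the extension to `L₊` satisfies `T̃ₜ 1 ≤ 1`. -/
structure IsMarkovianSemigroup (m : Measure X) [SigmaFinite m]
    (T : ℝ≥0 → Lp ℝ 2 m →L[ℝ] Lp ℝ 2 m) : Prop where
  map_zero : T 0 = ContinuousLinearMap.id ℝ (Lp ℝ 2 m)
  map_add : ∀ s t, T (s + t) = (T s).comp (T t)
  strongly_continuous : ∀ f, Tendsto (fun t => T t f) (𝓝 0) (𝓝 f)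
  contraction : ∀ t f, ‖T t f‖ ≤ ‖f‖
  symmetric : ∀ t f g, inner ℝ (T t f) g = inner ℝ f (T t g)
  positive : ∀ t f, 0 ≤ f → 0 ≤ T t f
  markov : ∀ t, posExt (T t) (1 : X →ₘ[m] ℝ≥0∞) ≤ 1

/-- `A` is invariant if `T̃ₜ 𝟙_A ≤ 𝟙_A` for all `t ≥ 0`. -/
def IsInvariantSet {m : Measure X} [SigmaFinite m] (T : ℝ≥0 → Lp ℝ 2 m →L[ℝ] Lp ℝ 2 m)
    {A : Set X} (hA : MeasurableSet A) : Prop :=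
  ∀ t, posExt (T t) (indClass m hA) ≤ indClass m hA

/-- Every invariant measurable set is null or conull. -/
def IsIrreducible {m : Measure X} [SigmaFinite m] (T : ℝ≥0 → Lp ℝ 2 m →L[ℝ] Lp ℝ 2 m) : Prop :=
  ∀ (A : Set X) (hA : MeasurableSet A), IsInvariantSet T hA → m A = 0 ∨ m Aᶜ = 0

/-- `S` is the operator on `L^p` induced by the operator `T` on `L²`: it is a bounded operator that
coincides with `T` on `L^p ∩ L²`. For `p < ∞` this determines `S`, by density; for `p = ∞` the
operator `S` is moreover required to be the adjoint of the operator induced by `T` on `L¹`, which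
need only be tested on the dense subspace `L¹ ∩ L²` of `L¹`. -/
structure IsInducedOn {m : Measure X} (p : ℝ≥0∞) [Fact (1 ≤ p)]
    (T : Lp ℝ 2 m →L[ℝ] Lp ℝ 2 m) (S : Lp ℝ p m →L[ℝ] Lp ℝ p m) : Prop where
  agree : ∀ (f : Lp ℝ 2 m) (g : Lp ℝ p m), f =ᵐ[m] g → T f =ᵐ[m] S g
  adjoint : p = ∞ → ∀ (f : Lp ℝ p m) (g : Lp ℝ 2 m), MemLp g 1 m →
    ∫ x, S f x * g x ∂m = ∫ x, f x * T g x ∂m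

open Classical in
/-- The operator on `L^p` induced by a member `T` of a Markovian semigroup on `L²`. For such `T` it
exists and is unique for every `p ∈ [1, ∞]`, so the value `0` is never taken. -/
def inducedOp {m : Measure X} (p : ℝ≥0∞) [Fact (1 ≤ p)]
    (T : Lp ℝ 2 m →L[ℝ] Lp ℝ 2 m) : Lp ℝ p m →L[ℝ] Lp ℝ p m :=
  if h : ∃ S : Lp ℝ p m →L[ℝ] Lp ℝ p m, IsInducedOn p T S then h.choose else 0

end Semigroup

/-! ### Order isomorphisms -/

section OrderIsomorphism

variable {X₁ X₂ : Type*} [MeasurableSpace X₁] [MeasurableSpace X₂]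
  {m₁ : Measure X₁} {m₂ : Measure X₂}

/-- An invertible positivity preserving linear map with positivity preserving inverse. -/
structure IsOrderIsomorphism {p : ℝ≥0∞} (U : Lp ℝ p m₁ ≃ₗ[ℝ] Lp ℝ p m₂) : Prop where
  positive : ∀ f, 0 ≤ f → 0 ≤ U f
  positive_symm : ∀ g, 0 ≤ g → 0 ≤ U.symm g

/-- `U : L^p(X₁) → L^p(X₂)` intertwines the semigroups induced on `L^p` by `T₁` and `T₂`. -/
def Intertwines {p : ℝ≥0∞} [Fact (1 ≤ p)] (U : Lp ℝ p m₁ ≃ₗ[ℝ] Lp ℝ p m₂)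
    (T₁ : ℝ≥0 → Lp ℝ 2 m₁ →L[ℝ] Lp ℝ 2 m₁) (T₂ : ℝ≥0 → Lp ℝ 2 m₂ →L[ℝ] Lp ℝ 2 m₂) : Prop :=
  ∀ t f, U (inducedOp p (T₁ t) f) = inducedOp p (T₂ t) (U f)

/-- `h : X₂ → (0, ∞)` and `τ : X₂ → X₁` are the scaling and the transformation of `U`: both are
measurable, `τ` has a measurable a.e. inverse, and `U f = h · (f ∘ τ)` for every `f` in `L^p` and
every representative of `f`. -/
structure IsScalingTransformation {p : ℝ≥0∞} (U : Lp ℝ p m₁ ≃ₗ[ℝ] Lp ℝ p m₂)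
    (h : X₂ → ℝ) (τ : X₂ → X₁) : Prop where
  measurable_scaling : Measurable h
  scaling_pos : ∀ y, 0 < h y
  measurable_transformation : Measurable τ
  ae_inverse : ∃ σ : X₁ → X₂, Measurable σ ∧
    (∀ᵐ y ∂m₂, σ (τ y) = y) ∧ (∀ᵐ x ∂m₁, τ (σ x) = x)
  eq_comp : ∀ (f : X₁ → ℝ) (hf : MemLp f p m₁), U (hf.toLp f) =ᵐ[m₂] fun y => h y * f (τ y)

/-- `V : L^q(X₂) → L^q(X₁)` is the adjoint of `U : L^p(X₁) → L^p(X₂)` for dual exponents `p, q`. -/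
def IsLpAdjoint {p q : ℝ≥0∞} [Fact (1 ≤ q)] (U : Lp ℝ p m₁ ≃ₗ[ℝ] Lp ℝ p m₂)
    (V : Lp ℝ q m₂ →L[ℝ] Lp ℝ q m₁) : Prop :=
  ∀ (f : Lp ℝ p m₁) (g : Lp ℝ q m₂), ∫ y, U f y * g y ∂m₂ = ∫ x, f x * V g x ∂m₁

end OrderIsomorphism

end OrderIntertwining

end

/-!
The theorem rests on three ideas.

*Order isomorphisms are weighted compositions.* Fix `w > 0` in `L^p(m₁)`. The operator `U` preserves
disjointness, so it maps each `𝟙_A w` to some `𝟙_B (U w)`, and it preserves suprema, so `A ↦ B` is a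
homomorphism of σ-algebras modulo null sets. Embedding `X₁` into `ℕ → Bool` turns it into a point
map `τ` (`IsOrderIsomorphism.exists_transformation`), and comparing `f` with `a w` for rational `a`
gives `U f / U w = (f / w) ∘ τ` (`IsOrderIsomorphism.div_apply_le`).

*Irreducibility makes the density constant.* Let `φ` be the density of `τ_#(h² m₂)` with respect to
`m₁`. Where everything is square integrable, `f ↦ h · (f ∘ τ)` intertwines the semigroups on `L²`,
and `⟨U f, U g⟩ = ∫ φ f g`. Since both semigroups are symmetric, `∫ φ g T f = ∫ φ f T g`. If `f` lives
on `{φ ≤ c}` and `g` on `{φ > c}`, then `∫ (φ - c) g T f = ∫ (φ - c) f T g` has sides of opposite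
signs, so `T f = 0` on `{g > 0}`. Hence every `{φ ≤ c}` is invariant, and `φ` is a constant `β`
(`IsScalingTransformation.exists_map_eq_smul`).

*Two integrability conditions bound the scaling.* The boundedness of `U` on `L^p`, which is
automatic, compares `h^p` with `h²`; applied to `U` and to its inverse it shows that `h^(p - 2)` and
`h^(2 - p)` are bounded (`IsScalingTransformation.exists_bound`). For `p ≠ 2` the formula
`f ↦ h · (f ∘ τ)` therefore defines an isomorphism `U^(r)` of every `L^r`. It intertwines the
semigroups by density if `r < ∞` and by duality if `r = ∞`. The adjoint of `U` is `β` times the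
inverse of `U^(q)`; for `p = 2` the operator `U` itself takes the place of `U^(q)`.

That the induced operators satisfy their defining relations uses the existence of the operators on
`L^r`, which comes from the contractivity of Markovian operators in the norm of `L^r`
(`IsMarkovianSemigroup.eLpNorm_apply_le`); this is a consequence of Jensen's inequality
`(T f)^r ≤ T (f^r)` and of the case `r = 1`.
-/

namespace OrderIntertwining

/-! ### Convergence in `L^p` -/

section Convergence

variable {X : Type*} [MeasurableSpace X] {m : Measure X}

theorem tendsto_Lp_of_tendsto_ae_of_norm_le {p : ℝ≥0∞} [Fact (1 ≤ p)] (hp : p ≠ ∞)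
    {F : ℕ → Lp ℝ p m} {f : Lp ℝ p m} (hbound : ∀ n, ∀ᵐ x ∂m, ‖F n x‖ ≤ ‖f x‖)
    (hlim : ∀ᵐ x ∂m, Tendsto (fun n => F n x) atTop (𝓝 (f x))) :
    Tendsto F atTop (𝓝 f) := by
  have hp1 : 1 ≤ p := Fact.out
  have hp0 : p ≠ 0 := (zero_lt_one.trans_le hp1).ne'
  have hpos : 0 < p.toReal := ENNReal.toReal_pos hp0 hp
  rw [Lp.tendsto_Lp_iff_tendsto_eLpNorm']
  simp_rw [eLpNorm_eq_lintegral_rpow_enorm_toReal hp0 hp]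
  have key : Tendsto (fun n => ∫⁻ x, ‖(⇑(F n) - ⇑f) x‖ₑ ^ p.toReal ∂m) atTop (𝓝 0) := by
    have := tendsto_lintegral_of_dominated_convergence' (μ := m)
      (F := fun n x => ‖(⇑(F n) - ⇑f) x‖ₑ ^ p.toReal) (f := fun _ => 0)
      (fun x => ‖(2 : ℝ) * f x‖ₑ ^ p.toReal) (fun n => ?_) (fun n => ?_) ?_ ?_
    · simpa using this
    · exact (((Lp.aestronglyMeasurable (F n)).sub (Lp.aestronglyMeasurable f)).enorm).pow_const _
    · filter_upwards [hbound n] with x hx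
      gcongr
      rw [enorm_le_iff_norm_le, Pi.sub_apply, norm_mul, Real.norm_ofNat]
      calc _ ≤ ‖F n x‖ + ‖f x‖ := norm_sub_le _ _
        _ ≤ _ := by linarith
    · have h2 : MemLp (fun x => (2 : ℝ) * f x) p m := (Lp.memLp f).const_mul 2
      have := lintegral_rpow_enorm_lt_top_of_eLpNorm_lt_top hp0 hp h2.2
      exact this.ne
    · filter_upwards [hlim] with x hx
      have h1 : Tendsto (fun n => ‖F n x - f x‖ₑ) atTop (𝓝 0) := by
        have := (hx.sub_const (f x)).enorm
        simpa using this
      have h2 := (ENNReal.continuous_rpow_const (y := p.toReal)).tendsto 0 |>.comp h1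
      simpa [ENNReal.zero_rpow_of_pos hpos, Function.comp_def] using h2
  have h2 := (ENNReal.continuous_rpow_const (y := 1 / p.toReal)).tendsto 0 |>.comp key
  simpa [ENNReal.zero_rpow_of_pos, hpos, Function.comp_def] using h2

theorem exists_subseq_tendsto_ae {p : ℝ≥0∞} [Fact (1 ≤ p)] {F : ℕ → Lp ℝ p m} {f : Lp ℝ p m}
    (h : Tendsto F atTop (𝓝 f)) : ∃ ns : ℕ → ℕ, StrictMono ns ∧
      ∀ᵐ x ∂m, Tendsto (fun i => F (ns i) x) atTop (𝓝 (f x)) :=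
  (tendstoInMeasure_of_tendsto_Lp h).exists_seq_tendsto_ae

theorem ae_le_of_tendsto_Lp {p : ℝ≥0∞} [Fact (1 ≤ p)] {F : ℕ → Lp ℝ p m} {f : Lp ℝ p m}
    (h : Tendsto F atTop (𝓝 f)) {g : X → ℝ} (hF : ∀ n, ∀ᵐ x ∂m, F n x ≤ g x) :
    ∀ᵐ x ∂m, f x ≤ g x := by
  obtain ⟨ns, -, hns⟩ := exists_subseq_tendsto_ae h
  filter_upwards [hns, ae_all_iff.2 hF] with x hx hx'
  exact le_of_tendsto' hx fun i => hx' _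

/-- The restriction of `f ∈ L^p` to the set `E n` of the exhaustion by sets of finite measure. -/
noncomputable def restrictSpanning [SigmaFinite m] {p : ℝ≥0∞} (f : Lp ℝ p m) (n : ℕ) : Lp ℝ p m :=
  ((Lp.memLp f).indicator (measurableSet_spanningSets m n)).toLp

theorem coeFn_restrictSpanning [SigmaFinite m] {p : ℝ≥0∞} (f : Lp ℝ p m) (n : ℕ) :
    restrictSpanning f n =ᵐ[m] (spanningSets m n).indicator f := MemLp.coeFn_toLp _

theorem tendsto_indicator_spanningSets [SigmaFinite m] (f : X → ℝ) (x : X) :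
    Tendsto (fun n => (spanningSets m n).indicator f x) atTop (𝓝 (f x)) := by
  refine tendsto_const_nhds.congr' ?_
  filter_upwards [eventually_mem_spanningSets m x] with n hn
  rw [Set.indicator_of_mem hn]

theorem tendsto_restrictSpanning [SigmaFinite m] {p : ℝ≥0∞} [Fact (1 ≤ p)] (hp : p ≠ ∞)
    (f : Lp ℝ p m) : Tendsto (restrictSpanning f) atTop (𝓝 f) := by
  refine tendsto_Lp_of_tendsto_ae_of_norm_le hp (fun n => ?_) ?_
  · filter_upwards [coeFn_restrictSpanning f n] with x hx
    rw [hx]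
    exact norm_indicator_le_norm_self _ _
  · filter_upwards [ae_all_iff.2 fun n => coeFn_restrictSpanning f n] with x hx
    simp_rw [hx]
    exact tendsto_indicator_spanningSets _ x

end Convergence

/-! ### Markovian operators: bounds in `L^1` and `L^∞` -/

namespace IsMarkovianSemigroup

variable {X : Type*} [MeasurableSpace X] {m : Measure X} [SigmaFinite m]
  {T : ℝ≥0 → Lp ℝ 2 m →L[ℝ] Lp ℝ 2 m}

theorem monotone (hT : IsMarkovianSemigroup m T) (t : ℝ≥0) : Monotone (T t) := fun f g h => by
  have := hT.positive t (g - f) (sub_nonneg.2 h)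
  rwa [map_sub, sub_nonneg] at this

theorem abs_le (hT : IsMarkovianSemigroup m T) (t : ℝ≥0) (f : Lp ℝ 2 m) : |T t f| ≤ T t |f| := by
  refine sup_le (hT.monotone t (le_abs_self f)) ?_
  rw [← map_neg]
  exact hT.monotone t (neg_le_abs f)

/-- The indicator function of the set `E n` of the exhaustion, as an element of `L²`. -/
noncomputable def spanningInd (m : Measure X) [SigmaFinite m] (n : ℕ) : Lp ℝ 2 m :=
  indicatorConstLp 2 (measurableSet_spanningSets m n) (measure_spanningSets_lt_top m n).ne 1

theorem coeFn_spanningInd (n : ℕ) :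
    spanningInd m n =ᵐ[m] (spanningSets m n).indicator fun _ => (1 : ℝ) :=
  indicatorConstLp_coeFn

theorem apply_spanningInd_le_one (hT : IsMarkovianSemigroup m T) (t : ℝ≥0) (n : ℕ) :
    ∀ᵐ x ∂m, T t (spanningInd m n) x ≤ 1 := by
  -- The index is shifted because the truncation `trunc 2 m 1 0` at height `0` vanishes.
  have h1 : spanningInd m n ≤ trunc 2 m 1 (n + 1) := by
    rw [← Lp.coeFn_le]
    filter_upwards [coeFn_spanningInd (m := m) n, (memLp_truncFun 2 m 1 (n + 1)).coeFn_toLp,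
      AEEqFun.coeFn_one (μ := m) (α := X) (β := ℝ≥0∞)] with x h1 h2 h3
    rw [h1, trunc, h2, truncFun]
    by_cases hx : x ∈ spanningSets m n
    · rw [Set.indicator_of_mem hx,
        Set.indicator_of_mem (monotone_spanningSets m (Nat.le_succ n) hx), h3]
      simp
    · rw [Set.indicator_of_notMem hx]
      exact Set.indicator_nonneg (fun _ _ => ENNReal.toReal_nonneg) _
  have h2 := hT.monotone t h1
  have h3 : posExt (T t) (1 : X →ₘ[m] ℝ≥0∞) ≤ᵐ[m] (1 : X →ₘ[m] ℝ≥0∞) :=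
    AEEqFun.coeFn_le.2 (hT.markov t)
  rw [← Lp.coeFn_le] at h2
  filter_upwards [h2, h3, AEEqFun.coeFn_one (μ := m) (α := X) (β := ℝ≥0∞),
    AEEqFun.coeFn_mk _ (AEMeasurable.iSup fun n =>
      (Lp.aestronglyMeasurable (T t (trunc 2 m 1 n))).aemeasurable.ennreal_ofReal).aestronglyMeasurable]
    with x hx hx' h1 h4
  refine hx.trans ?_
  rw [h1, posExt, h4] at hx'
  have h5 := (le_iSup (fun n => ENNReal.ofReal (T t (trunc 2 m 1 n) x)) (n + 1)).trans hx'
  simpa using h5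

/-- Contractivity on `L^∞`, extracted from the condition `T̃ 𝟙 ≤ 1` on `L₊`. -/
theorem apply_le_const (hT : IsMarkovianSemigroup m T) (t : ℝ≥0) {f : Lp ℝ 2 m} {c : ℝ}
    (hc : 0 ≤ c) (hf : ∀ᵐ x ∂m, f x ≤ c) : ∀ᵐ x ∂m, T t f x ≤ c := by
  refine ae_le_of_tendsto_Lp (((T t).continuous.tendsto f).comp
    (tendsto_restrictSpanning (by simp) f)) fun n => ?_
  have h1 : restrictSpanning f n ≤ c • spanningInd m n := by
    rw [← Lp.coeFn_le]
    filter_upwards [coeFn_restrictSpanning f n, coeFn_spanningInd (m := m) n,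
      Lp.coeFn_smul c (spanningInd m n), hf] with x h1 h2 h3 h4
    rw [h1, h3, Pi.smul_apply, h2]
    by_cases hx : x ∈ spanningSets m n <;> simp [hx, h4]
  have h2 := hT.monotone t h1
  rw [map_smul, ← Lp.coeFn_le] at h2
  filter_upwards [h2, Lp.coeFn_smul c (T t (spanningInd m n)), hT.apply_spanningInd_le_one t n]
    with x h1 h2 h3
  refine h1.trans ?_
  rw [h2, Pi.smul_apply, smul_eq_mul]
  exact mul_le_of_le_one_right hc h3

theorem coeFn_nonneg (hT : IsMarkovianSemigroup m T) (t : ℝ≥0) {f : Lp ℝ 2 m}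
    (hf : 0 ≤ f) : ∀ᵐ x ∂m, 0 ≤ T t f x := (Lp.coeFn_nonneg _).2 (hT.positive t f hf)

/-- Contractivity on `L¹`, dual to `T 𝟙 ≤ 1`: `∫_{E n} T f = ∫ f T 𝟙_{E n} ≤ ∫ f`. -/
theorem lintegral_apply_le (hT : IsMarkovianSemigroup m T) (t : ℝ≥0) {f : Lp ℝ 2 m}
    (hf : 0 ≤ f) : ∫⁻ x, ENNReal.ofReal (T t f x) ∂m ≤ ∫⁻ x, ENNReal.ofReal (f x) ∂m := by
  have hf' : ∀ᵐ x ∂m, 0 ≤ f x := (Lp.coeFn_nonneg _).2 hf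
  by_cases hfin : ∫⁻ x, ENNReal.ofReal (f x) ∂m = ∞
  · rw [hfin]; exact le_top
  have hint : Integrable f m := by
    refine ⟨Lp.aestronglyMeasurable f, ?_⟩
    rw [hasFiniteIntegral_iff_ofReal hf']
    exact lt_top_iff_ne_top.2 hfin
  have hstep : ∀ n, ∫⁻ x in spanningSets m n, ENNReal.ofReal (T t f x) ∂m
      ≤ ∫⁻ x, ENNReal.ofReal (f x) ∂m := fun n => by
    have hfinm := measure_spanningSets_lt_top m n
    have hTn : Integrable (T t f) (m.restrict (spanningSets m n)) :=
      integrableOn_Lp_of_measure_ne_top _ (by norm_num) hfinm.ne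
    rw [← ofReal_integral_eq_lintegral_ofReal hTn (ae_restrict_of_ae (hT.coeFn_nonneg t hf)),
      ← ofReal_integral_eq_lintegral_ofReal hint hf']
    refine ENNReal.ofReal_le_ofReal ?_
    have h1 := L2.inner_indicatorConstLp_one (𝕜 := ℝ) (measurableSet_spanningSets m n) hfinm.ne
      (T t f)
    rw [← h1, ← hT.symmetric, L2.inner_def]
    refine integral_mono_ae (L2.integrable_inner _ _) hint ?_
    filter_upwards [hf', hT.apply_spanningInd_le_one t n] with x hx hx'
    exact mul_le_of_le_one_right hx hx'
  rw [← setLIntegral_univ, ← iUnion_spanningSets m,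
    setLIntegral_iUnion_of_directed _ (monotone_spanningSets m).directed_le]
  exact iSup_le hstep

end IsMarkovianSemigroup

/-! ### Contractivity of Markovian operators on `L^r` -/

section Auxiliary

variable {X : Type*} [MeasurableSpace X] {m : Measure X}

theorem memLp_indicator_of_bound {A : Set X} (hA : MeasurableSet A) (hfin : m A ≠ ∞) (p : ℝ≥0∞)
    {f : X → ℝ} (hf : AEStronglyMeasurable f m) (C : ℝ) (hC : ∀ᵐ x ∂m, x ∈ A → |f x| ≤ C) :
    MemLp (A.indicator f) p m := by
  rw [memLp_indicator_iff_restrict hA]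
  have : IsFiniteMeasure (m.restrict A) := ⟨by simpa using hfin.lt_top⟩
  exact MemLp.of_bound hf.restrict C ((ae_restrict_iff' hA).2 hC)

theorem dense_setOf_forall_memLp {r : ℝ≥0∞} [Fact (1 ≤ r)] (hr : r ≠ ∞) :
    Dense {g : Lp ℝ r m | ∀ p : ℝ≥0∞, MemLp g p m} := by
  have hr0 : r ≠ 0 := (zero_lt_one.trans_le (Fact.out : 1 ≤ r)).ne'
  refine Dense.mono ?_ (Lp.simpleFunc.denseRange (E := ℝ) (μ := m) hr)
  rintro _ ⟨s, rfl⟩ p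
  have h1 := Lp.simpleFunc.memLp s
  exact (SimpleFunc.memLp_of_finite_measure_preimage p fun y hy =>
    SimpleFunc.measure_preimage_lt_top_of_memLp hr0 hr _ h1 y hy).ae_eq
      (Lp.simpleFunc.toSimpleFunc_eq_toFun s)

end Auxiliary

theorem tangent_le_rpow {r a x : ℝ} (hr : 1 ≤ r) (ha : 0 < a) (hx : 0 ≤ x) :
    r * a ^ (r - 1) * x - (r - 1) * a ^ r ≤ x ^ r := by
  have h1 := one_add_mul_self_le_rpow_one_add (s := x / a - 1) (by
    have := div_nonneg hx ha.le
    linarith) hr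
  rw [add_sub_cancel, Real.div_rpow hx ha.le, le_div_iff₀ (Real.rpow_pos_of_pos ha r)] at h1
  refine le_trans (le_of_eq ?_) h1
  have h2 : a ^ r = a ^ (r - 1) * a := by
    rw [← Real.rpow_add_one ha.ne', sub_add_cancel]
  rw [h2]
  field_simp
  ring

/-- A power is the supremum of its tangent lines at positive rational points. -/
theorem rpow_le_of_forall_rat {r u v : ℝ} (hr : 1 ≤ r) (hu : 0 ≤ u) (hv : 0 ≤ v)
    (h : ∀ q : ℚ, 0 < q → r * (q : ℝ) ^ (r - 1) * u - (r - 1) * (q : ℝ) ^ r ≤ v) : u ^ r ≤ v := by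
  rcases hu.eq_or_lt with rfl | hu
  · rwa [Real.zero_rpow (by linarith)]
  by_contra! hlt
  have hc : ContinuousAt (fun a : ℝ => r * a ^ (r - 1) * u - (r - 1) * a ^ r) u := by
    have h1 := Real.continuousAt_rpow_const u (r - 1) (Or.inl hu.ne')
    have h2 := Real.continuousAt_rpow_const u r (Or.inl hu.ne')
    exact ((h1.const_mul r).mul_const u).sub (h2.const_mul (r - 1))
  have hval : r * u ^ (r - 1) * u - (r - 1) * u ^ r = u ^ r := by
    have h2 : u ^ r = u ^ (r - 1) * u := by
      rw [← Real.rpow_add_one hu.ne', sub_add_cancel]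
    rw [h2]; ring
  have hev := hc.eventually (lt_mem_nhds (hval.symm ▸ hlt))
  obtain ⟨_, ⟨q, rfl⟩, hq1, hq2⟩ := ((mem_closure_iff_frequently.1
    (Rat.denseRange_cast (𝕜 := ℝ) u)).and_eventually (hev.and (lt_mem_nhds hu))).exists
  exact absurd (h q (by exact_mod_cast hq2)) (not_le.2 hq1)

namespace IsMarkovianSemigroup

variable {X : Type*} [MeasurableSpace X] {m : Measure X} [SigmaFinite m]
  {T : ℝ≥0 → Lp ℝ 2 m →L[ℝ] Lp ℝ 2 m}

/-- Jensen's inequality `(T f)^r ≤ T (f^r)` for bounded functions supported in some `E n`: the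
tangent lines of `x ↦ x ^ r` at rational points are preserved by `T`, since `T 𝟙 ≤ 1`. -/
theorem rpow_apply_le (hT : IsMarkovianSemigroup m T) (t : ℝ≥0) {r : ℝ} (hr : 1 ≤ r) (n : ℕ)
    {f g : Lp ℝ 2 m} (hf : 0 ≤ f) (hsupp : ∀ᵐ x ∂m, x ∉ spanningSets m n → f x = 0)
    (hg : ∀ᵐ x ∂m, g x = f x ^ r) :
    ∀ᵐ x ∂m, T t f x ^ r ≤ T t g x := by
  have hf' : ∀ᵐ x ∂m, 0 ≤ f x := (Lp.coeFn_nonneg _).2 hf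
  have hg0 : 0 ≤ g := by
    rw [← Lp.coeFn_nonneg]
    filter_upwards [hg, hf'] with x h1 h2
    rw [h1]
    exact Real.rpow_nonneg h2 r
  have key : ∀ q : ℚ, 0 < q → ∀ᵐ x ∂m,
      r * (q : ℝ) ^ (r - 1) * T t f x - (r - 1) * (q : ℝ) ^ r ≤ T t g x := fun q hq => by
    have hq' : (0 : ℝ) < q := by exact_mod_cast hq
    have h1 : (r * (q : ℝ) ^ (r - 1)) • f - ((r - 1) * (q : ℝ) ^ r) • spanningInd m n ≤ g := by
      rw [← Lp.coeFn_le]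
      filter_upwards [hf', hsupp, hg, coeFn_spanningInd (m := m) n,
        Lp.coeFn_sub ((r * (q : ℝ) ^ (r - 1)) • f) (((r - 1) * (q : ℝ) ^ r) • spanningInd m n),
        Lp.coeFn_smul (r * (q : ℝ) ^ (r - 1)) f,
        Lp.coeFn_smul ((r - 1) * (q : ℝ) ^ r) (spanningInd m n)] with x h1 h2 h3 h4 h5 h6 h7
      rw [h5, Pi.sub_apply, h6, h7, Pi.smul_apply, Pi.smul_apply, h3, h4, smul_eq_mul, smul_eq_mul]
      by_cases hx : x ∈ spanningSets m n
      · simpa [hx] using tangent_le_rpow hr hq' h1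
      · simp [hx, h2 hx, Real.zero_rpow (by linarith : r ≠ 0)]
    have h2 := hT.monotone t h1
    rw [map_sub, map_smul, map_smul, ← Lp.coeFn_le] at h2
    filter_upwards [h2, hT.apply_spanningInd_le_one t n,
      Lp.coeFn_sub ((r * (q : ℝ) ^ (r - 1)) • T t f)
        (((r - 1) * (q : ℝ) ^ r) • T t (spanningInd m n)),
      Lp.coeFn_smul (r * (q : ℝ) ^ (r - 1)) (T t f),
      Lp.coeFn_smul ((r - 1) * (q : ℝ) ^ r) (T t (spanningInd m n))] with x h2 h3 h5 h6 h7
    rw [h5, Pi.sub_apply, h6, h7, Pi.smul_apply, Pi.smul_apply, smul_eq_mul, smul_eq_mul] at h2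
    have h8 : 0 ≤ (r - 1) * (q : ℝ) ^ r := mul_nonneg (by linarith) (Real.rpow_nonneg hq'.le _)
    nlinarith [mul_le_mul_of_nonneg_left h3 h8]
  have key' := ae_all_iff.2 fun q : ℚ => (eventually_imp_distrib_left.2 (key q))
  filter_upwards [key', hT.coeFn_nonneg t hf, hT.coeFn_nonneg t hg0] with x h1 h2 h3
  exact rpow_le_of_forall_rat hr h2 h3 h1

theorem eLpNorm_apply_le_of_bounded (hT : IsMarkovianSemigroup m T) (t : ℝ≥0) {r : ℝ≥0∞}
    (hr1 : 1 ≤ r) (hr : r ≠ ∞) (n : ℕ) {f : Lp ℝ 2 m} (hf : 0 ≤ f)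
    (hsupp : ∀ᵐ x ∂m, x ∉ spanningSets m n → f x = 0) (C : ℝ) (hC : ∀ᵐ x ∂m, f x ≤ C) :
    eLpNorm (T t f) r m ≤ eLpNorm f r m := by
  have hr0 : r ≠ 0 := (zero_lt_one.trans_le hr1).ne'
  have hf' : ∀ᵐ x ∂m, 0 ≤ f x := (Lp.coeFn_nonneg _).2 hf
  have hr1' : 1 ≤ r.toReal := by
    simpa using ENNReal.toReal_mono hr hr1
  have hmem : MemLp ((spanningSets m n).indicator fun x => f x ^ r.toReal) 2 m := by
    refine memLp_indicator_of_bound (measurableSet_spanningSets m n)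
      (measure_spanningSets_lt_top m n).ne 2
      ((Lp.aestronglyMeasurable f).aemeasurable.pow_const _).aestronglyMeasurable
      (C ^ r.toReal) ?_
    filter_upwards [hf', hC] with x h1 h2 _
    rw [abs_of_nonneg (Real.rpow_nonneg h1 _)]
    exact Real.rpow_le_rpow h1 h2 (by linarith)
  have hg : ∀ᵐ x ∂m, (hmem.toLp _ : Lp ℝ 2 m) x = f x ^ r.toReal := by
    filter_upwards [hmem.coeFn_toLp, hsupp] with x h1 h2
    rw [h1]
    by_cases hx : x ∈ spanningSets m n
    · simp [hx]
    · simp [hx, h2 hx, Real.zero_rpow (by linarith : r.toReal ≠ 0)]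
  have hg0 : 0 ≤ hmem.toLp _ := by
    rw [← Lp.coeFn_nonneg]
    filter_upwards [hg, hf'] with x h1 h2
    rw [h1]
    exact Real.rpow_nonneg h2 _
  have h1 := hT.rpow_apply_le t hr1' n hf hsupp hg
  have h2 := hT.lintegral_apply_le t hg0
  rw [eLpNorm_eq_lintegral_rpow_enorm_toReal hr0 hr, eLpNorm_eq_lintegral_rpow_enorm_toReal hr0 hr]
  gcongr ?_ ^ _
  calc ∫⁻ x, ‖T t f x‖ₑ ^ r.toReal ∂m ≤ ∫⁻ x, ENNReal.ofReal (T t (hmem.toLp _) x) ∂m := by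
        refine lintegral_mono_ae ?_
        filter_upwards [h1, hT.coeFn_nonneg t hf] with x hx hx'
        rw [Real.enorm_eq_ofReal hx', ENNReal.ofReal_rpow_of_nonneg hx' (by linarith)]
        exact ENNReal.ofReal_le_ofReal hx
    _ ≤ ∫⁻ x, ENNReal.ofReal ((hmem.toLp _ : Lp ℝ 2 m) x) ∂m := h2
    _ = ∫⁻ x, ‖f x‖ₑ ^ r.toReal ∂m := by
        refine lintegral_congr_ae ?_
        filter_upwards [hg, hf'] with x hx hx'
        rw [hx, Real.enorm_eq_ofReal hx', ENNReal.ofReal_rpow_of_nonneg hx' (by linarith)]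

theorem eLpNorm_apply_le_of_nonneg (hT : IsMarkovianSemigroup m T) (t : ℝ≥0) {r : ℝ≥0∞}
    (hr1 : 1 ≤ r) (hr : r ≠ ∞) {f : Lp ℝ 2 m} (hf : 0 ≤ f) :
    eLpNorm (T t f) r m ≤ eLpNorm f r m := by
  have hf' : ∀ᵐ x ∂m, 0 ≤ f x := (Lp.coeFn_nonneg _).2 hf
  have hmem : ∀ n : ℕ, MemLp ((spanningSets m n).indicator fun x => min (f x) n) 2 m := fun n => by
    refine memLp_indicator_of_bound (measurableSet_spanningSets m n)
      (measure_spanningSets_lt_top m n).ne 2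
      ((Lp.aestronglyMeasurable f).inf aestronglyMeasurable_const) n ?_
    filter_upwards [hf'] with x h1 _
    rw [abs_of_nonneg (le_min h1 (Nat.cast_nonneg n))]
    exact min_le_right _ _
  set F : ℕ → Lp ℝ 2 m := fun n => (hmem n).toLp with hF
  have hFx : ∀ᵐ x ∂m, ∀ n, F n x = (spanningSets m n).indicator (fun x => min (f x) n) x :=
    ae_all_iff.2 fun n => (hmem n).coeFn_toLp
  have hbd : ∀ᵐ x ∂m, ∀ n, 0 ≤ F n x ∧ F n x ≤ f x := by
    filter_upwards [hFx, hf'] with x h1 h2 n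
    rw [h1]
    by_cases hx : x ∈ spanningSets m n <;> simp [hx, h2]
  have hlim : Tendsto F atTop (𝓝 f) := by
    refine tendsto_Lp_of_tendsto_ae_of_norm_le (by simp) (fun n => ?_) ?_
    · filter_upwards [hbd] with x hx
      obtain ⟨h1, h2⟩ := hx n
      rwa [Real.norm_of_nonneg h1, Real.norm_of_nonneg (h1.trans h2)]
    · filter_upwards [hFx] with x hx
      refine tendsto_const_nhds.congr' ?_
      filter_upwards [eventually_mem_spanningSets m x,
        (tendsto_natCast_atTop_atTop (R := ℝ)).eventually_ge_atTop (f x)] with n h1 h2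
      rw [hx, Set.indicator_of_mem h1, min_eq_left h2]
  obtain ⟨ns, -, hns⟩ := exists_subseq_tendsto_ae (((T t).continuous.tendsto f).comp hlim)
  refine (Lp.eLpNorm_lim_le_liminf_eLpNorm (f := fun i => T t (F (ns i)))
    (fun i => Lp.aestronglyMeasurable _) _ hns).trans ?_
  refine liminf_le_of_le (by isBoundedDefault) fun b hb => ?_
  obtain ⟨i, hi⟩ := hb.exists
  refine hi.trans ((hT.eLpNorm_apply_le_of_bounded t hr1 hr (ns i) ?_ ?_ (ns i) ?_).trans ?_)
  · rw [← Lp.coeFn_nonneg]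
    filter_upwards [hbd] with x hx using (hx _).1
  · filter_upwards [hFx] with x hx hx'
    rw [hx, Set.indicator_of_notMem hx']
  · filter_upwards [hFx] with x hx
    rw [hx]
    by_cases hx : x ∈ spanningSets m (ns i) <;> simp [hx]
  · refine eLpNorm_mono_ae ?_
    filter_upwards [hbd] with x hx
    obtain ⟨h1, h2⟩ := hx (ns i)
    rwa [Real.norm_of_nonneg h1, Real.norm_of_nonneg (h1.trans h2)]

/-- A Markovian operator is a contraction for the norm of `L^r`, for every `r ∈ [1, ∞]`. -/
theorem eLpNorm_apply_le (hT : IsMarkovianSemigroup m T) (t : ℝ≥0) {r : ℝ≥0∞}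
    (hr1 : 1 ≤ r) (f : Lp ℝ 2 m) : eLpNorm (T t f) r m ≤ eLpNorm f r m := by
  have habs : ∀ᵐ x ∂m, ‖T t f x‖ ≤ T t |f| x := by
    have := hT.abs_le t f
    rw [← Lp.coeFn_le] at this
    filter_upwards [this, Lp.coeFn_abs (T t f)] with x h1 h2
    rwa [h2] at h1
  rcases eq_or_ne r ∞ with rfl | hr
  · by_cases htop : eLpNorm f ∞ m = ∞
    · rw [htop]; exact le_top
    rw [eLpNorm_exponent_top] at htop ⊢
    rw [eLpNorm_exponent_top]
    have h1 : ∀ᵐ x ∂m, |f| x ≤ (eLpNormEssSup f m).toReal := by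
      filter_upwards [ae_le_eLpNormEssSup (f := f) (μ := m), Lp.coeFn_abs f] with x hx hx'
      rw [hx', ← Real.norm_eq_abs, ← toReal_enorm]
      exact ENNReal.toReal_mono htop hx
    refine (eLpNormEssSup_le_of_ae_bound (C := (eLpNormEssSup f m).toReal) ?_).trans
      (ENNReal.ofReal_toReal htop).le
    filter_upwards [habs, hT.apply_le_const t ENNReal.toReal_nonneg h1] with x h2 h3
    exact h2.trans h3
  · calc eLpNorm (T t f) r m ≤ eLpNorm (T t |f|) r m := by
          refine eLpNorm_mono_ae ?_
          filter_upwards [habs] with x hx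
          exact hx.trans (le_abs_self _)
      _ ≤ eLpNorm (|f| : Lp ℝ 2 m) r m := hT.eLpNorm_apply_le_of_nonneg t hr1 hr (abs_nonneg f)
      _ = eLpNorm f r m := by
          refine eLpNorm_congr_norm_ae ?_
          filter_upwards [Lp.coeFn_abs f] with x hx
          rw [hx, Real.norm_eq_abs, abs_abs, Real.norm_eq_abs]

theorem memLp_apply (hT : IsMarkovianSemigroup m T) (t : ℝ≥0) {r : ℝ≥0∞}
    (hr1 : 1 ≤ r) {f : Lp ℝ 2 m} (hf : MemLp f r m) : MemLp (T t f) r m :=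
  ⟨Lp.aestronglyMeasurable _, (hT.eLpNorm_apply_le t hr1 f).trans_lt hf.2⟩

/-- For `r < ∞` the induced operator is the continuous extension from the dense space
`L² ∩ L^r`, here mapped into `L^r` by `e`. -/
theorem exists_isInducedOn_of_ne_top (hT : IsMarkovianSemigroup m T) (t : ℝ≥0) (r : ℝ≥0∞)
    [Fact (1 ≤ r)] (hr : r ≠ ∞) : ∃ S, IsInducedOn r (T t) S := by
  have hr1 : 1 ≤ r := Fact.out
  let D : Submodule ℝ (Lp ℝ 2 m) :=
    { carrier := {f | MemLp f r m}
      add_mem' := fun {f g} hf hg => (MemLp.add hf hg).ae_eq (Lp.coeFn_add f g).symm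
      zero_mem' := (MemLp.zero (ε := ℝ)).ae_eq (Lp.coeFn_zero ℝ 2 m).symm
      smul_mem' := fun c f hf => (MemLp.const_smul hf c).ae_eq (Lp.coeFn_smul c f).symm }
  let e : D →ₗ[ℝ] Lp ℝ r m :=
    { toFun := fun f => MemLp.toLp f f.2
      map_add' := fun f g => by
        rw [← MemLp.toLp_add]
        exact MemLp.toLp_congr _ _ (Lp.coeFn_add _ _)
      map_smul' := fun c f => by
        rw [RingHom.id_apply, ← MemLp.toLp_const_smul]
        exact MemLp.toLp_congr _ _ (Lp.coeFn_smul _ _) }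
  let T' : D →ₗ[ℝ] Lp ℝ r m :=
    { toFun := fun f => MemLp.toLp (T t f) (hT.memLp_apply t hr1 f.2)
      map_add' := fun f g => by
        rw [← MemLp.toLp_add]
        refine MemLp.toLp_congr _ _ ?_
        rw [Submodule.coe_add, _root_.map_add]
        exact Lp.coeFn_add _ _
      map_smul' := fun c f => by
        rw [RingHom.id_apply, ← MemLp.toLp_const_smul]
        refine MemLp.toLp_congr _ _ ?_
        rw [Submodule.coe_smul, map_smul]
        exact Lp.coeFn_smul _ _ }
  have hD : ∀ x : D, MemLp (x : Lp ℝ 2 m) r m := fun x => x.2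
  have he : ∀ x : D, e x =ᵐ[m] (x : Lp ℝ 2 m) := fun x => MemLp.coeFn_toLp (hD x)
  have hT' : ∀ x : D, T' x =ᵐ[m] T t (x : Lp ℝ 2 m) := fun x =>
    MemLp.coeFn_toLp (hT.memLp_apply t hr1 (hD x))
  clear_value e T'
  have hdense : DenseRange e := by
    refine (dense_setOf_forall_memLp hr).mono fun g hg => ?_
    have h2 : MemLp g 2 m := hg 2
    exact ⟨⟨h2.toLp _, (hg r).ae_eq h2.coeFn_toLp.symm⟩, Lp.ext ((he _).trans h2.coeFn_toLp)⟩
  have hnorm : ∃ C, ∀ x, ‖T' x‖ ≤ C * ‖e x‖ := by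
    refine ⟨1, fun x => ?_⟩
    rw [one_mul, Lp.norm_def, Lp.norm_def, eLpNorm_congr_ae (he x), eLpNorm_congr_ae (hT' x)]
    exact ENNReal.toReal_mono (hD x).2.ne (hT.eLpNorm_apply_le t hr1 x)
  refine ⟨T'.extendOfNorm e, fun f g hfg => ?_, fun h => absurd h hr⟩
  let f' : D := ⟨f, (Lp.memLp g).ae_eq hfg.symm⟩
  have h1 : e f' = g := Lp.ext ((he f').trans hfg)
  have h2 := T'.extendOfNorm_eq hdense hnorm f'
  rw [h1] at h2
  rw [h2]
  exact (hT' f').symm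

end IsMarkovianSemigroup

/-! ### The induced operator on `L^∞` -/

section Top

variable {X : Type*} [MeasurableSpace X] {m : Measure X}

theorem ae_abs_le_norm_of_top (f : Lp ℝ ∞ m) : ∀ᵐ x ∂m, |f x| ≤ ‖f‖ := by
  have h := Lp.eLpNorm_ne_top f
  rw [eLpNorm_exponent_top] at h
  filter_upwards [ae_le_eLpNormEssSup (f := f) (μ := m)] with x hx
  rw [Lp.norm_def, eLpNorm_exponent_top, ← Real.norm_eq_abs, ← toReal_enorm]
  exact ENNReal.toReal_mono h hx

theorem norm_le_of_ae_abs_le {f : Lp ℝ ∞ m} {C : ℝ} (hC : 0 ≤ C) (h : ∀ᵐ x ∂m, |f x| ≤ C) :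
    ‖f‖ ≤ C := by
  rw [Lp.norm_def, eLpNorm_exponent_top]
  exact ENNReal.toReal_le_of_le_ofReal hC (eLpNormEssSup_le_of_ae_bound h)

variable [SigmaFinite m]

theorem memLp_indicator_spanningSets (f : Lp ℝ ∞ m) (p : ℝ≥0∞) (n : ℕ) :
    MemLp ((spanningSets m n).indicator f) p m :=
  memLp_indicator_of_bound (measurableSet_spanningSets m n) (measure_spanningSets_lt_top m n).ne p
    (Lp.aestronglyMeasurable f) ‖f‖ ((ae_abs_le_norm_of_top f).mono fun _ h _ => h)

/-- The restriction of `f ∈ L^∞` to the set `E n` of finite measure, as an element of `L²`. -/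
noncomputable def cutTop (f : Lp ℝ ∞ m) (n : ℕ) : Lp ℝ 2 m :=
  (memLp_indicator_spanningSets f 2 n).toLp

theorem coeFn_cutTop (f : Lp ℝ ∞ m) (n : ℕ) :
    cutTop f n =ᵐ[m] (spanningSets m n).indicator f := MemLp.coeFn_toLp _

theorem cutTop_add (f g : Lp ℝ ∞ m) (n : ℕ) : cutTop (f + g) n = cutTop f n + cutTop g n := by
  refine Lp.ext ?_
  filter_upwards [coeFn_cutTop (f + g) n, coeFn_cutTop f n, coeFn_cutTop g n,
    Lp.coeFn_add (cutTop f n) (cutTop g n), Lp.coeFn_add f g] with x h1 h2 h3 h4 h5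
  rw [h1, h4, Pi.add_apply, h2, h3]
  by_cases hx : x ∈ spanningSets m n
  · simp only [Set.indicator_of_mem hx, h5, Pi.add_apply]
  · simp [hx]

theorem cutTop_smul (c : ℝ) (f : Lp ℝ ∞ m) (n : ℕ) : cutTop (c • f) n = c • cutTop f n := by
  refine Lp.ext ?_
  filter_upwards [coeFn_cutTop (c • f) n, coeFn_cutTop f n,
    Lp.coeFn_smul c (cutTop f n), Lp.coeFn_smul c f] with x h1 h2 h4 h5
  rw [h1, h4, Pi.smul_apply, h2]
  by_cases hx : x ∈ spanningSets m n
  · simp only [Set.indicator_of_mem hx, h5, Pi.smul_apply]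
  · simp [hx]

namespace IsMarkovianSemigroup

variable {T : ℝ≥0 → Lp ℝ 2 m →L[ℝ] Lp ℝ 2 m}

theorem abs_apply_cutTop_le (hT : IsMarkovianSemigroup m T) (t : ℝ≥0) (f : Lp ℝ ∞ m) (n : ℕ) :
    ∀ᵐ x ∂m, |T t (cutTop f n) x| ≤ ‖f‖ := by
  have h := hT.abs_le t (cutTop f n)
  rw [← Lp.coeFn_le] at h
  have h1 : ∀ᵐ x ∂m, |cutTop f n| x ≤ ‖f‖ := by
    filter_upwards [Lp.coeFn_abs (cutTop f n), coeFn_cutTop f n, ae_abs_le_norm_of_top f]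
      with x h1 h2 h3
    rw [h1, h2]
    by_cases hx : x ∈ spanningSets m n <;> simp [hx, h3]
  filter_upwards [h, hT.apply_le_const t (norm_nonneg f) h1, Lp.coeFn_abs (T t (cutTop f n))]
    with x h2 h3 h4
  rw [h4] at h2
  exact h2.trans h3

/-- For `f ≥ 0` the sequence `T (f 𝟙_{E n})` is increasing and bounded by `‖f‖`. -/
theorem exists_tendsto_apply_cutTop_of_nonneg (hT : IsMarkovianSemigroup m T) (t : ℝ≥0)
    {f : Lp ℝ ∞ m} (hf : 0 ≤ f) :
    ∀ᵐ x ∂m, ∃ l, Tendsto (fun n => T t (cutTop f n) x) atTop (𝓝 l) := by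
  have hf' : ∀ᵐ x ∂m, 0 ≤ f x := (Lp.coeFn_nonneg _).2 hf
  have hmono : ∀ n, T t (cutTop f n) ≤ T t (cutTop f (n + 1)) := fun n => by
    refine hT.monotone t ?_
    rw [← Lp.coeFn_le]
    filter_upwards [coeFn_cutTop f n, coeFn_cutTop f (n + 1), hf'] with x h1 h2 h3
    rw [h1, h2]
    by_cases hx : x ∈ spanningSets m n
    · simp [hx, monotone_spanningSets m (Nat.le_succ n) hx]
    · rw [Set.indicator_of_notMem hx]
      exact Set.indicator_apply_nonneg fun _ => h3
  have hmono' := ae_all_iff.2 fun n => (Lp.coeFn_le _ _).2 (hmono n)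
  filter_upwards [hmono', ae_all_iff.2 fun n => hT.abs_apply_cutTop_le t f n] with x h1 h2
  refine ⟨_, tendsto_atTop_ciSup (monotone_nat_of_le_succ h1) ⟨‖f‖, ?_⟩⟩
  rintro _ ⟨n, rfl⟩
  exact (le_abs_self _).trans (h2 n)

theorem exists_tendsto_apply_cutTop (hT : IsMarkovianSemigroup m T) (t : ℝ≥0) (f : Lp ℝ ∞ m) :
    ∃ g : Lp ℝ ∞ m, ‖g‖ ≤ ‖f‖ ∧
      ∀ᵐ x ∂m, Tendsto (fun n => T t (cutTop f n) x) atTop (𝓝 (g x)) := by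
  have hlim : ∀ᵐ x ∂m, ∃ l, Tendsto (fun n => T t (cutTop f n) x) atTop (𝓝 l) := by
    have hsub : ∀ n, T t (cutTop f n) = T t (cutTop f⁺ n) + (-1 : ℝ) • T t (cutTop f⁻ n) :=
      fun n => by
        rw [← map_smul, ← _root_.map_add, ← cutTop_smul, ← cutTop_add, neg_one_smul,
          ← sub_eq_add_neg, posPart_sub_negPart]
    filter_upwards [hT.exists_tendsto_apply_cutTop_of_nonneg t (posPart_nonneg f),
      hT.exists_tendsto_apply_cutTop_of_nonneg t (negPart_nonneg f),
      ae_all_iff.2 fun n => Lp.coeFn_add (T t (cutTop f⁺ n)) ((-1 : ℝ) • T t (cutTop f⁻ n)),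
      ae_all_iff.2 fun n => Lp.coeFn_smul (-1 : ℝ) (T t (cutTop f⁻ n))]
      with x ⟨l, hl⟩ ⟨l', hl'⟩ h1 h2
    refine ⟨l + (-1) * l', (hl.add (hl'.const_mul (-1))).congr fun n => ?_⟩
    rw [hsub, h1, Pi.add_apply, h2, Pi.smul_apply, smul_eq_mul]
  obtain ⟨g, hg, hlim⟩ := measurable_limit_of_tendsto_metrizable_ae
    (fun n => (Lp.aestronglyMeasurable (T t (cutTop f n))).aemeasurable) hlim
  have hbound : ∀ᵐ x ∂m, |g x| ≤ ‖f‖ := by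
    filter_upwards [hlim, ae_all_iff.2 fun n => hT.abs_apply_cutTop_le t f n] with x h1 h2
    exact le_of_tendsto' h1.abs h2
  have hmem : MemLp g ∞ m := memLp_top_of_bound hg.aestronglyMeasurable ‖f‖ hbound
  refine ⟨hmem.toLp, norm_le_of_ae_abs_le (norm_nonneg f) ?_, ?_⟩
  · filter_upwards [hbound, hmem.coeFn_toLp] with x h1 h2
    rwa [h2]
  · filter_upwards [hlim, hmem.coeFn_toLp] with x h1 h2
    rwa [h2]

/-- On `L^∞` the induced operator is the almost everywhere limit of `T (f 𝟙_{E n})`. -/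
theorem exists_isInducedOn_top (hT : IsMarkovianSemigroup m T) (t : ℝ≥0) :
    ∃ S : Lp ℝ ∞ m →L[ℝ] Lp ℝ ∞ m, IsInducedOn ∞ (T t) S := by
  choose S hS hlim using hT.exists_tendsto_apply_cutTop t
  have hadd : ∀ f g, S (f + g) = S f + S g := fun f g => by
    refine Lp.ext ?_
    filter_upwards [hlim f, hlim g, hlim (f + g), Lp.coeFn_add (S f) (S g),
      ae_all_iff.2 fun n => Lp.coeFn_add (T t (cutTop f n)) (T t (cutTop g n))] with x h1 h2 h3 h4 h5
    rw [h4]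
    refine tendsto_nhds_unique h3 ((h1.add h2).congr fun n => ?_)
    rw [cutTop_add, _root_.map_add, h5, Pi.add_apply]
  have hsmul : ∀ (c : ℝ) f, S (c • f) = c • S f := fun c f => by
    refine Lp.ext ?_
    filter_upwards [hlim f, hlim (c • f), Lp.coeFn_smul c (S f),
      ae_all_iff.2 fun n => Lp.coeFn_smul c (T t (cutTop f n))] with x h1 h3 h4 h5
    rw [h4]
    refine tendsto_nhds_unique h3 ((h1.const_mul c).congr fun n => ?_)
    rw [cutTop_smul, map_smul, h5, Pi.smul_apply, smul_eq_mul]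
  refine ⟨LinearMap.mkContinuous ⟨⟨S, hadd⟩, hsmul⟩ 1 fun f => by simpa using hS f, ?_, ?_⟩
  · intro f g hfg
    have hcut : ∀ n, cutTop g n = restrictSpanning f n := fun n => by
      refine Lp.ext ?_
      filter_upwards [coeFn_cutTop g n, coeFn_restrictSpanning f n, hfg] with x h1 h2 h3
      rw [h1, h2]
      by_cases hx : x ∈ spanningSets m n <;> simp [hx, h3]
    have h1 : Tendsto (fun n => T t (cutTop g n)) atTop (𝓝 (T t f)) := by
      simp_rw [hcut]
      exact ((T t).continuous.tendsto f).comp (tendsto_restrictSpanning (by simp) f)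
    obtain ⟨ns, hns, h2⟩ := exists_subseq_tendsto_ae h1
    filter_upwards [h2, hlim g] with x h2 h3
    exact tendsto_nhds_unique h2 (h3.comp hns.tendsto_atTop)
  · intro _ f g hg
    change ∫ x, S f x * g x ∂m = ∫ x, f x * T t g x ∂m
    have hTg : MemLp (T t g) 1 m := hT.memLp_apply t le_rfl hg
    have h1 : Tendsto (fun n => ∫ x, T t (cutTop f n) x * g x ∂m) atTop
        (𝓝 (∫ x, S f x * g x ∂m)) := by
      refine tendsto_integral_of_dominated_convergence (fun x => ‖f‖ * |g x|)
        (fun n => (Lp.aestronglyMeasurable _).mul (Lp.aestronglyMeasurable _))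
        ((memLp_one_iff_integrable.1 hg).abs.const_mul _) (fun n => ?_) ?_
      · filter_upwards [hT.abs_apply_cutTop_le t f n] with x hx
        rw [norm_mul]
        exact mul_le_mul_of_nonneg_right hx (norm_nonneg _)
      · filter_upwards [hlim f] with x hx using hx.mul_const _
    have h2 : Tendsto (fun n => ∫ x, cutTop f n x * T t g x ∂m) atTop
        (𝓝 (∫ x, f x * T t g x ∂m)) := by
      refine tendsto_integral_of_dominated_convergence (fun x => ‖f‖ * |T t g x|)
        (fun n => (Lp.aestronglyMeasurable _).mul (Lp.aestronglyMeasurable _))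
        ((memLp_one_iff_integrable.1 hTg).abs.const_mul _) (fun n => ?_) ?_
      · filter_upwards [coeFn_cutTop f n, ae_abs_le_norm_of_top f] with x hx hx'
        rw [norm_mul, hx]
        refine mul_le_mul_of_nonneg_right ((norm_indicator_le_norm_self _ _).trans hx')
          (norm_nonneg _)
      · filter_upwards [ae_all_iff.2 fun n => coeFn_cutTop f n] with x hx
        simp_rw [hx]
        exact (tendsto_indicator_spanningSets _ x).mul_const _
    refine tendsto_nhds_unique h1 (h2.congr fun n => ?_)
    have h3 := hT.symmetric t (cutTop f n) g
    rw [L2.inner_def, L2.inner_def] at h3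
    simp only [RCLike.inner_apply, conj_trivial] at h3
    simp_rw [mul_comm] at h3 ⊢
    exact h3.symm

/-- The chosen operator `inducedOp` is not the default value `0`. -/
theorem isInducedOn_inducedOp (hT : IsMarkovianSemigroup m T) (t : ℝ≥0) (r : ℝ≥0∞)
    [Fact (1 ≤ r)] : IsInducedOn r (T t) (inducedOp r (T t)) := by
  have h : ∃ S, IsInducedOn r (T t) S := by
    rcases eq_or_ne r ∞ with rfl | hr
    · exact hT.exists_isInducedOn_top t
    · exact hT.exists_isInducedOn_of_ne_top t r hr
  rw [inducedOp, dif_pos h]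
  exact h.choose_spec

end IsMarkovianSemigroup
end Top

/-! ### Order isomorphisms of `L^p`-spaces -/

section OrderIso

variable {X₁ X₂ : Type*} [MeasurableSpace X₁] [MeasurableSpace X₂]
  {m₁ : Measure X₁} {m₂ : Measure X₂} {p : ℝ≥0∞}

instance instPosSMulMonoLp : PosSMulMono ℝ (Lp ℝ p m₁) where
  smul_le_smul_of_nonneg_left c hc f g hfg := by
    rw [← Lp.coeFn_le] at hfg ⊢
    filter_upwards [hfg, Lp.coeFn_smul c f, Lp.coeFn_smul c g] with x h1 h2 h3
    rw [h2, h3]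
    exact mul_le_mul_of_nonneg_left h1 hc

namespace IsOrderIsomorphism

variable {U : Lp ℝ p m₁ ≃ₗ[ℝ] Lp ℝ p m₂}

theorem symm (hU : IsOrderIsomorphism U) : IsOrderIsomorphism U.symm where
  positive := hU.positive_symm
  positive_symm := hU.positive

theorem monotone (hU : IsOrderIsomorphism U) : Monotone U := fun f g h => by
  have := hU.positive (g - f) (sub_nonneg.2 h)
  rwa [map_sub, sub_nonneg] at this

/-- An order isomorphism as an isomorphism of partially ordered sets. -/
def toOrderIso (hU : IsOrderIsomorphism U) : Lp ℝ p m₁ ≃o Lp ℝ p m₂ where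
  toEquiv := U.toEquiv
  map_rel_iff' {f g} := ⟨fun h => by simpa using hU.symm.monotone h, fun h => hU.monotone h⟩

theorem map_inf (hU : IsOrderIsomorphism U) (f g : Lp ℝ p m₁) : U (f ⊓ g) = U f ⊓ U g :=
  OrderIso.map_inf hU.toOrderIso f g

theorem map_sup (hU : IsOrderIsomorphism U) (f g : Lp ℝ p m₁) : U (f ⊔ g) = U f ⊔ U g :=
  OrderIso.map_sup hU.toOrderIso f g

/-- A positive operator between Banach lattices is bounded: otherwise there are unit vectors `f n`
with `4 ^ n ≤ ‖U (f n)‖`, and `U` could not be defined at `∑ n, 2 ^ (-n) • |f n|`. -/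
theorem exists_norm_le [Fact (1 ≤ p)] (hU : IsOrderIsomorphism U) :
    ∃ C : ℝ, 0 < C ∧ ∀ f, ‖U f‖ ≤ C * ‖f‖ := by
  by_contra! hcon
  have h4 : ∀ n : ℕ, ∃ f : Lp ℝ p m₁, ‖f‖ = 1 ∧ (4 : ℝ) ^ n ≤ ‖U f‖ := fun n => by
    obtain ⟨f, hf⟩ := hcon (4 ^ n) (by positivity)
    have hf0 : 0 < ‖f‖ := by
      rw [norm_pos_iff]
      rintro rfl
      simp at hf
    refine ⟨‖f‖⁻¹ • f, ?_, ?_⟩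
    · rw [norm_smul, norm_inv, norm_norm, inv_mul_cancel₀ hf0.ne']
    · rw [map_smul, norm_smul, norm_inv, norm_norm, ← div_eq_inv_mul, le_div_iff₀ hf0]
      exact hf.le
  choose f hf1 hf2 using h4
  have hsum : Summable fun n => ((1 / 2 : ℝ) ^ n) • |f n| := by
    refine Summable.of_norm ?_
    simp_rw [norm_smul, norm_abs_eq_norm, hf1, mul_one, norm_pow]
    exact summable_geometric_of_lt_one (by norm_num) (by norm_num)
  set g := ∑' n, ((1 / 2 : ℝ) ^ n) • |f n|
  have hle : ∀ n, ((1 / 2 : ℝ) ^ n) • |f n| ≤ g := fun n =>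
    hsum.le_tsum n fun i _ => smul_nonneg (by positivity) (abs_nonneg _)
  have hbound : ∀ n : ℕ, (2 : ℝ) ^ n ≤ ‖U g‖ := fun n => by
    have h1 := hU.monotone (hle n)
    rw [map_smul] at h1
    have h2 : |U (f n)| ≤ U |f n| := by
      refine sup_le (hU.monotone (le_abs_self _)) ?_
      rw [← map_neg]
      exact hU.monotone (neg_le_abs _)
    have h3 : ((1 / 2 : ℝ) ^ n) • |U (f n)| ≤ U g :=
      (smul_le_smul_of_nonneg_left h2 (by positivity)).trans h1
    have h4 : ‖((1 / 2 : ℝ) ^ n) • |U (f n)|‖ ≤ ‖U g‖ := by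
      refine HasSolidNorm.solid ?_
      rw [abs_of_nonneg (smul_nonneg (by positivity) (abs_nonneg _))]
      exact h3.trans (le_abs_self _)
    rw [norm_smul, norm_abs_eq_norm, norm_pow] at h4
    have h5 : (2 : ℝ) ^ n = (1 / 2) ^ n * 4 ^ n := by
      rw [← mul_pow]; norm_num
    rw [h5]
    refine (mul_le_mul_of_nonneg_left (hf2 n) (by positivity)).trans (le_trans (le_of_eq ?_) h4)
    norm_num
  obtain ⟨n, hn⟩ := pow_unbounded_of_one_lt ‖U g‖ (one_lt_two : (1 : ℝ) < 2)
  exact absurd (hbound n) (not_le.2 hn)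

theorem continuous [Fact (1 ≤ p)] (hU : IsOrderIsomorphism U) : Continuous U := by
  obtain ⟨C, -, hC⟩ := hU.exists_norm_le
  exact (U.toLinearMap.mkContinuous C hC).continuous

end IsOrderIsomorphism

theorem exists_pos_memLp (m : Measure X₁) [SigmaFinite m] (hp0 : p ≠ 0) (hp : p ≠ ∞) :
    ∃ w : X₁ → ℝ, Measurable w ∧ (∀ x, 0 < w x) ∧ MemLp w p m := by
  obtain ⟨g, hg0, hg, hgint⟩ := exists_pos_lintegral_lt_of_sigmaFinite m one_ne_zero
  have hp' := ENNReal.toReal_pos hp0 hp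
  refine ⟨fun x => (g x : ℝ) ^ (1 / p.toReal), by fun_prop,
    fun x => Real.rpow_pos_of_pos (by exact_mod_cast hg0 x) _, ?_⟩
  refine ⟨(by fun_prop : Measurable _).aestronglyMeasurable, ?_⟩
  rw [eLpNorm_lt_top_iff_lintegral_rpow_enorm_lt_top hp0 hp]
  refine lt_of_eq_of_lt (lintegral_congr fun x => ?_) (hgint.trans ENNReal.one_lt_top)
  have h0 : (0 : ℝ) ≤ g x := (g x).2
  rw [Real.enorm_eq_ofReal (Real.rpow_nonneg h0 _),
    ENNReal.ofReal_rpow_of_nonneg (Real.rpow_nonneg h0 _) hp'.le, ← Real.rpow_mul h0,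
    one_div_mul_cancel hp'.ne', Real.rpow_one, ENNReal.ofReal_coe_nnreal]

/-! ### Order isomorphisms are weighted compositions -/

section Representation

variable {U : Lp ℝ p m₁ ≃ₗ[ℝ] Lp ℝ p m₂}

/-- `U` maps weak units to weak units: an indicator function `b` of a part of `{U w = 0}` satisfies
`b ⊓ U w = 0`, hence `U⁻¹ b ⊓ w = 0`, hence `U⁻¹ b = 0`. -/
theorem IsOrderIsomorphism.apply_pos [SigmaFinite m₂] (hU : IsOrderIsomorphism U)
    {w : Lp ℝ p m₁} (hw : ∀ᵐ x ∂m₁, 0 < w x) : ∀ᵐ y ∂m₂, 0 < U w y := by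
  have hU0 : 0 ≤ U w := hU.positive w ((Lp.coeFn_nonneg _).1 (hw.mono fun x h => h.le))
  rw [← Lp.coeFn_nonneg] at hU0
  have hmeas : MeasurableSet {y | U w y ≤ 0} :=
    (Lp.stronglyMeasurable (U w)).measurable measurableSet_Iic
  rw [ae_iff]
  simp_rw [not_lt]
  refine (Measure.forall_measure_inter_isCountablySpanning_eq_zero
    (isCountablySpanning_spanningSets m₂)).1 ?_
  rintro _ ⟨n, rfl⟩
  set N := {y | U w y ≤ 0} ∩ spanningSets m₂ n
  have hN : MeasurableSet N := hmeas.inter (measurableSet_spanningSets m₂ n)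
  have hfin : m₂ N ≠ ∞ := measure_ne_top_of_subset Set.inter_subset_right
    (measure_spanningSets_lt_top m₂ n).ne
  set b : Lp ℝ p m₂ := indicatorConstLp p hN hfin 1
  have hb : b =ᵐ[m₂] N.indicator fun _ => (1 : ℝ) := indicatorConstLp_coeFn
  have hb0 : 0 ≤ b := by
    rw [← Lp.coeFn_nonneg]
    filter_upwards [hb] with y hy
    rw [hy]
    exact Set.indicator_apply_nonneg fun _ => zero_le_one
  have hbU : b ⊓ U w = 0 := by
    refine Lp.ext ?_
    filter_upwards [Lp.coeFn_inf b (U w), hb, hU0, Lp.coeFn_zero ℝ p m₂] with y h1 h2 h3 h4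
    rw [h1, h4, Pi.inf_apply, h2]
    change (0 : ℝ) ≤ U w y at h3
    by_cases hy : y ∈ N
    · rw [Set.indicator_of_mem hy, le_antisymm hy.1 h3]
      simp
    · simp [hy, h3]
  have hf : U.symm b = 0 := by
    have h1 : U.symm b ⊓ w = 0 := by
      rw [← U.symm_apply_apply w, ← hU.symm.map_inf, hbU, map_zero]
    refine Lp.ext ?_
    filter_upwards [Lp.coeFn_inf (U.symm b) w, Lp.coeFn_zero ℝ p m₁, hw] with x h2 h3 h4
    rw [h1, h3, Pi.inf_apply] at h2
    rw [h3]
    change (0 : ℝ) = min (U.symm b x) (w x) at h2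
    change U.symm b x = 0
    rcases min_choice (U.symm b x) (w x) with h | h <;> linarith
  have hb00 : b = 0 := by rw [← U.apply_symm_apply b, hf, map_zero]
  rw [measure_eq_zero_iff_ae_notMem]
  filter_upwards [hb, Lp.coeFn_zero ℝ p m₂] with y h1 h2 hy
  rw [hb00, h2, Set.indicator_of_mem hy] at h1
  exact zero_ne_one h1

/-- An order isomorphism maps the functions `𝟙_A w`, with `w > 0` fixed, to functions of the form
`𝟙_B (U w)`. -/
theorem IsOrderIsomorphism.exists_apply_indicator (hU : IsOrderIsomorphism U)
    {w : X₁ → ℝ} (hw : MemLp w p m₁) (hpos : ∀ x, 0 < w x) {A : Set X₁} (hA : MeasurableSet A) :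
    ∃ B : Set X₂, MeasurableSet B ∧
      U ((hw.indicator hA).toLp _) =ᵐ[m₂] B.indicator (U (hw.toLp w)) := by
  have hdisj : (hw.indicator hA).toLp _ ⊓ (hw.indicator hA.compl).toLp _ = 0 := by
    refine Lp.ext ?_
    filter_upwards [Lp.coeFn_inf ((hw.indicator hA).toLp _) ((hw.indicator hA.compl).toLp _),
      (hw.indicator hA).coeFn_toLp, (hw.indicator hA.compl).coeFn_toLp, Lp.coeFn_zero ℝ p m₁]
      with x h1 h2 h3 h4
    rw [h1, h4, Pi.inf_apply, h2, h3]
    by_cases hx : x ∈ A <;> simp [hx, (hpos x).le]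
  have hadd : hw.toLp w = (hw.indicator hA).toLp _ + (hw.indicator hA.compl).toLp _ := by
    rw [← MemLp.toLp_add]
    refine MemLp.toLp_congr _ _ (Eventually.of_forall fun x => ?_)
    rw [Set.indicator_self_add_compl]
  set a := U ((hw.indicator hA).toLp _)
  set b := U ((hw.indicator hA.compl).toLp _) with hb
  have h1 : a ⊓ b = 0 := by rw [← hU.map_inf, hdisj, map_zero]
  refine ⟨{y | 0 < a y}, (Lp.stronglyMeasurable a).measurable measurableSet_Ioi, ?_⟩
  rw [hadd, map_add]
  filter_upwards [Lp.coeFn_inf a b, Lp.coeFn_add a b, Lp.coeFn_zero ℝ p m₂] with y h2 h3 h4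
  rw [h1, h4, Pi.inf_apply] at h2
  change (0 : ℝ) = min (a y) (b y) at h2
  by_cases hy : 0 < a y
  · rw [Set.indicator_of_mem (by exact hy), h3, Pi.add_apply]
    rcases min_choice (a y) (b y) with h | h <;> linarith
  · rw [Set.indicator_of_notMem (by exact hy)]
    have := min_le_left (a y) (b y)
    linarith

/-- Point realization of an order isomorphism. With an injection `e : X₁ → ℕ → Bool` and its left
inverse `l`, the coordinates of `F : X₂ → ℕ → Bool` are read off from the images of the generating
sets `{x | e x n = true}`, and `τ = l ∘ F`. -/
theorem IsOrderIsomorphism.exists_transformation [StandardBorelSpace X₁] [Nonempty X₁]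
    [SigmaFinite m₂] (hU : IsOrderIsomorphism U) {w : X₁ → ℝ} (hw : MemLp w p m₁)
    (hpos : ∀ x, 0 < w x) :
    ∃ τ : X₂ → X₁, Measurable τ ∧ ∀ (A : Set X₁) (hA : MeasurableSet A),
      U ((hw.indicator hA).toLp _) =ᵐ[m₂] (τ ⁻¹' A).indicator (U (hw.toLp w)) := by
  classical
  obtain ⟨e, hem, hei⟩ := MeasurableSpace.measurable_injection_nat_bool_of_countablySeparated X₁
  obtain ⟨l, hl, hle⟩ := (hem.measurableEmbedding hei).exists_measurable_extend measurable_id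
    fun _ => ‹Nonempty X₁›
  have hgen : ∀ n : ℕ, MeasurableSet {z : ℕ → Bool | z n = true} := fun n =>
    measurableSet_eq_fun (measurable_pi_apply n) measurable_const
  choose B hB hUB using fun n => hU.exists_apply_indicator hw hpos (hem (hgen n))
  have hk0 : ∀ᵐ y ∂m₂, 0 < U (hw.toLp w) y := hU.apply_pos (by
    filter_upwards [hw.coeFn_toLp] with x hx
    rw [hx]
    exact hpos x)
  let F : X₂ → ℕ → Bool := fun y n => decide (y ∈ B n)
  have hF : Measurable F := measurable_pi_lambda _ fun n => measurable_to_bool (by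
    convert hB n using 1
    ext y
    simp [F])
  -- The sets whose indicator functions are transported by `F` form a σ-algebra.
  let M : MeasurableSpace (ℕ → Bool) :=
    { MeasurableSet' := fun S => ∃ hS : MeasurableSet S,
        U ((hw.indicator (hem hS)).toLp _) =ᵐ[m₂] (F ⁻¹' S).indicator (U (hw.toLp w))
      measurableSet_empty := by
        refine ⟨MeasurableSet.empty, ?_⟩
        have h0 : (hw.indicator (hem MeasurableSet.empty)).toLp _ = 0 := by
          rw [← MemLp.toLp_zero (MemLp.zero' (ε := ℝ))]
          exact MemLp.toLp_congr _ _ (by simp; rfl)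
        rw [h0, map_zero]
        rw [Set.preimage_empty, Set.indicator_empty']
        exact Lp.coeFn_zero ℝ p m₂
      measurableSet_compl := by
        rintro S ⟨hS, h⟩
        refine ⟨hS.compl, ?_⟩
        have hsub : (hw.indicator (hem hS.compl)).toLp _
            = hw.toLp w - (hw.indicator (hem hS)).toLp _ := by
          rw [← MemLp.toLp_sub]
          refine MemLp.toLp_congr _ _ (Eventually.of_forall fun x => ?_)
          rw [Set.preimage_compl, Set.indicator_compl]
        rw [hsub, map_sub]
        filter_upwards [h, Lp.coeFn_sub (U (hw.toLp w)) (U ((hw.indicator (hem hS)).toLp _))]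
          with y h1 h2
        rw [h2, Pi.sub_apply, h1, Set.preimage_compl, Set.indicator_compl, Pi.sub_apply]
      measurableSet_iUnion := by
        intro S hS
        choose hS hUS using hS
        refine ⟨MeasurableSet.iUnion hS, ?_⟩
        have hG := (Lp.memLp (U (hw.toLp w))).indicator (hF (MeasurableSet.iUnion hS))
        have hle : U ((hw.indicator (hem (MeasurableSet.iUnion hS))).toLp _) ≤ hG.toLp _ := by
          have : (hw.indicator (hem (MeasurableSet.iUnion hS))).toLp _ ≤ U.symm (hG.toLp _) := by
            have hn : ∀ n, (hw.indicator (hem (hS n))).toLp _ ≤ U.symm (hG.toLp _) := fun n => by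
              have : U ((hw.indicator (hem (hS n))).toLp _) ≤ hG.toLp _ := by
                rw [← Lp.coeFn_le]
                filter_upwards [hUS n, hG.coeFn_toLp, hk0] with y h1 h2 h3
                rw [h1, h2]
                exact Set.indicator_le_indicator_apply_of_subset
                  (Set.preimage_mono (Set.subset_iUnion S n)) h3.le
              simpa using hU.symm.monotone this
            have h0 : 0 ≤ U.symm (hG.toLp _) := by
              refine hU.positive_symm _ ?_
              rw [← Lp.coeFn_nonneg]
              filter_upwards [hG.coeFn_toLp, hk0] with y h2 h3
              rw [h2]
              exact Set.indicator_apply_nonneg fun _ => h3.le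
            rw [← Lp.coeFn_nonneg] at h0
            rw [← Lp.coeFn_le]
            filter_upwards [h0, ae_all_iff.2 fun n => (Lp.coeFn_le _ _).2 (hn n),
              ae_all_iff.2 fun n => (hw.indicator (hem (hS n))).coeFn_toLp,
              (hw.indicator (hem (MeasurableSet.iUnion hS))).coeFn_toLp] with x h0 h1 h2 h3
            rw [h3]
            by_cases hx : x ∈ e ⁻¹' ⋃ n, S n
            · obtain ⟨n, hn⟩ := Set.mem_iUnion.1 (Set.mem_preimage.1 hx)
              have := h1 n
              rw [h2, Set.indicator_of_mem (by exact hn)] at this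
              rwa [Set.indicator_of_mem hx]
            · rw [Set.indicator_of_notMem hx]
              exact h0
          simpa using hU.monotone this
        have hge : ∀ n, U ((hw.indicator (hem (hS n))).toLp _) ≤
            U ((hw.indicator (hem (MeasurableSet.iUnion hS))).toLp _) := fun n => by
          refine hU.monotone ?_
          rw [← Lp.coeFn_le]
          filter_upwards [(hw.indicator (hem (hS n))).coeFn_toLp,
            (hw.indicator (hem (MeasurableSet.iUnion hS))).coeFn_toLp] with x h1 h2
          rw [h1, h2]
          exact Set.indicator_le_indicator_of_subset
            (Set.preimage_mono (Set.subset_iUnion S n)) (fun _ => (hpos _).le) x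
        have hnn : 0 ≤ U ((hw.indicator (hem (MeasurableSet.iUnion hS))).toLp _) := by
          refine hU.positive _ ?_
          rw [← Lp.coeFn_nonneg]
          filter_upwards [(hw.indicator (hem (MeasurableSet.iUnion hS))).coeFn_toLp] with x h2
          rw [h2]
          exact Set.indicator_apply_nonneg fun _ => (hpos _).le
        rw [← Lp.coeFn_le] at hle
        rw [← Lp.coeFn_nonneg] at hnn
        filter_upwards [hle, hnn, hG.coeFn_toLp, ae_all_iff.2 hUS,
          ae_all_iff.2 fun n => (Lp.coeFn_le _ _).2 (hge n)] with y h1 h2 h3 h4 h5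
        rw [h3] at h1
        refine le_antisymm h1 ?_
        by_cases hy : y ∈ F ⁻¹' ⋃ n, S n
        · obtain ⟨n, hn⟩ := Set.mem_iUnion.1 (Set.mem_preimage.1 hy)
          have := h5 n
          rw [h4, Set.indicator_of_mem (by exact hn)] at this
          rwa [Set.indicator_of_mem hy]
        · rw [Set.indicator_of_notMem hy]
          exact h2 }
  have hM : MeasurableSpace.pi ≤ M := by
    refine iSup_le fun n => ?_
    rw [← measurable_iff_comap_le]
    refine @measurable_to_bool _ M _ ⟨hgen n, ?_⟩
    refine (hUB n).trans (Eventually.of_forall fun y => ?_)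
    congr 1
    ext y
    simp [F]
  refine ⟨l ∘ F, hl.comp hF, fun A hA => ?_⟩
  obtain ⟨hS, h⟩ := hM _ (hl hA)
  have hpre : e ⁻¹' (l ⁻¹' A) = A := by
    rw [← Set.preimage_comp, hle, Set.preimage_id]
  rw [Set.preimage_comp]
  have heq : (hw.indicator hA).toLp _ = (hw.indicator (hem (hl hA))).toLp _ :=
    MemLp.toLp_congr _ _ (by rw [hpre])
  rw [heq]
  exact h

end Representation
end OrderIso

section Existence

variable {X₁ X₂ : Type*} [MeasurableSpace X₁] [MeasurableSpace X₂]
  {m₁ : Measure X₁} {m₂ : Measure X₂} {p : ℝ≥0∞} {U : Lp ℝ p m₁ ≃ₗ[ℝ] Lp ℝ p m₂}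

/-- If `τ` transports the functions `𝟙_A w` under `U`, then `U f / U w ≤ (f / w) ∘ τ`: for rational
`a`, the function `(f - a w)⁺` is disjoint from `𝟙_A w`, where `A = {f ≤ a w}`, and hence
`(U f - a U w)⁺` vanishes on `τ⁻¹ A`. -/
theorem IsOrderIsomorphism.div_apply_le (hU : IsOrderIsomorphism U)
    {w : X₁ → ℝ} (hw : MemLp w p m₁) (hpos : ∀ x, 0 < w x) (hwm : Measurable w)
    (hk : ∀ᵐ y ∂m₂, 0 < U (hw.toLp w) y) {τ : X₂ → X₁}
    (hτ : ∀ (A : Set X₁) (hA : MeasurableSet A),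
      U ((hw.indicator hA).toLp _) =ᵐ[m₂] (τ ⁻¹' A).indicator (U (hw.toLp w)))
    (f : Lp ℝ p m₁) : ∀ᵐ y ∂m₂, U f y / U (hw.toLp w) y ≤ f (τ y) / w (τ y) := by
  have key : ∀ a : ℚ, ∀ᵐ y ∂m₂, f (τ y) / w (τ y) ≤ a → U f y / U (hw.toLp w) y ≤ a := fun a => by
    set W := hw.toLp w with hW
    have hWx : W =ᵐ[m₁] w := hw.coeFn_toLp
    have hA : MeasurableSet {x | f x / w x ≤ a} :=
      measurableSet_le ((Lp.stronglyMeasurable f).measurable.div hwm) measurable_const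
    set A := {x | f x / w x ≤ a}
    set g : Lp ℝ p m₁ := (f - (a : ℝ) • W) ⊔ 0
    have hg : U g = (U f - (a : ℝ) • U W) ⊔ 0 := by
      rw [hU.map_sup, map_sub, map_smul, map_zero]
    have hdisj : g ⊓ (hw.indicator hA).toLp _ = 0 := by
      refine Lp.ext ?_
      filter_upwards [Lp.coeFn_inf g ((hw.indicator hA).toLp _), (hw.indicator hA).coeFn_toLp,
        Lp.coeFn_sup (f - (a : ℝ) • W) 0, Lp.coeFn_sub f ((a : ℝ) • W), Lp.coeFn_smul (a : ℝ) W,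
        hWx, Lp.coeFn_zero ℝ p m₁] with x h1 h2 h3 h4 h5 h6 h7
      rw [h1, Pi.inf_apply, h2, h3, Pi.sup_apply, h4, Pi.sub_apply, h5, Pi.smul_apply, h6, h7]
      by_cases hx : x ∈ A
      · have hx' : f x ≤ a * w x := (div_le_iff₀ (hpos x)).1 hx
        rw [Set.indicator_of_mem hx, smul_eq_mul, Pi.zero_apply, sup_eq_right.2 (by linarith)]
        exact inf_eq_left.2 (hpos x).le
      · rw [Set.indicator_of_notMem hx]
        exact inf_eq_right.2 le_sup_right
    have hdisj' : U g ⊓ U ((hw.indicator hA).toLp _) = 0 := by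
      rw [← hU.map_inf, hdisj, map_zero]
    rw [hg] at hdisj'
    filter_upwards [Lp.coeFn_inf ((U f - (a : ℝ) • U W) ⊔ 0) (U ((hw.indicator hA).toLp _)), hτ A hA,
      Lp.coeFn_sup (U f - (a : ℝ) • U W) 0, Lp.coeFn_sub (U f) ((a : ℝ) • U W),
      Lp.coeFn_smul (a : ℝ) (U W), Lp.coeFn_zero ℝ p m₂, hk] with y h1 h2 h3 h4 h5 h6 h7 hy
    rw [hdisj', Pi.inf_apply, h2, h3, Pi.sup_apply, h4, Pi.sub_apply, h5, Pi.smul_apply, h6,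
      Set.indicator_of_mem (by exact hy), Pi.zero_apply, smul_eq_mul] at h1
    rw [div_le_iff₀ h7]
    have h8 := le_sup_left (a := U f y - a * U W y) (b := 0)
    rcases min_choice ((U f y - a * U W y) ⊔ 0) (U W y) with h | h
    · have h9 : (U f y - a * U W y) ⊔ 0 = 0 := h.symm.trans h1.symm
      linarith
    · have h9 : U W y = 0 := h.symm.trans h1.symm
      linarith
  filter_upwards [ae_all_iff.2 key] with y hy
  by_contra! hlt
  obtain ⟨a, h1, h2⟩ := exists_rat_btwn hlt
  exact absurd (hy a h1.le) (not_le.2 h2)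

theorem IsOrderIsomorphism.exists_weighted_composition [StandardBorelSpace X₁] [Nonempty X₁]
    [SigmaFinite m₁] [SigmaFinite m₂] (hp0 : p ≠ 0) (hp : p ≠ ∞) (hU : IsOrderIsomorphism U) :
    ∃ (h : X₂ → ℝ) (τ : X₂ → X₁), Measurable h ∧ (∀ y, 0 < h y) ∧
      Measure.QuasiMeasurePreserving τ m₂ m₁ ∧
      ∀ (f : X₁ → ℝ) (hf : MemLp f p m₁), U (hf.toLp f) =ᵐ[m₂] fun y => h y * f (τ y) := by
  obtain ⟨w, hwm, hpos, hw⟩ := exists_pos_memLp m₁ hp0 hp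
  have hk : ∀ᵐ y ∂m₂, 0 < U (hw.toLp w) y := hU.apply_pos (by
    filter_upwards [hw.coeFn_toLp] with x hx
    rw [hx]
    exact hpos x)
  obtain ⟨τ, hτm, hτ⟩ := hU.exists_transformation hw hpos
  have hqmp : Measure.QuasiMeasurePreserving τ m₂ m₁ := by
    refine ⟨hτm, Measure.AbsolutelyContinuous.mk fun A hA hA0 => ?_⟩
    rw [Measure.map_apply hτm hA, measure_eq_zero_iff_ae_notMem]
    have h0 : (hw.indicator hA).toLp _ = 0 := by
      refine Lp.ext ?_
      filter_upwards [(hw.indicator hA).coeFn_toLp, Lp.coeFn_zero ℝ p m₁,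
        measure_eq_zero_iff_ae_notMem.1 hA0] with x h1 h2 h3
      rw [h1, h2, Set.indicator_of_notMem h3, Pi.zero_apply]
    have h1 := hτ A hA
    rw [h0, map_zero] at h1
    filter_upwards [h1, Lp.coeFn_zero ℝ p m₂, hk] with y h1 h2 h3 hy
    rw [h2, Set.indicator_of_mem hy] at h1
    exact h3.ne h1
  have hformula : ∀ f : Lp ℝ p m₁, ∀ᵐ y ∂m₂,
      U f y / U (hw.toLp w) y = f (τ y) / w (τ y) := fun f => by
    filter_upwards [hU.div_apply_le hw hpos hwm hk hτ f, hU.div_apply_le hw hpos hwm hk hτ (-f),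
      hqmp.ae (Lp.coeFn_neg f), Lp.coeFn_neg (U f)] with y h1 h2 h3 h4
    rw [map_neg, h3, h4, Pi.neg_apply, Pi.neg_apply, neg_div, neg_div, neg_le_neg_iff] at h2
    exact le_antisymm h1 h2
  have hkm := (Lp.stronglyMeasurable (U (hw.toLp w))).measurable
  classical
  refine ⟨fun y => if 0 < U (hw.toLp w) y then U (hw.toLp w) y / w (τ y) else 1, τ,
    Measurable.ite (hkm measurableSet_Ioi) (hkm.div (hwm.comp hτm)) measurable_const,
    fun y => ?_, hqmp, fun f hf => ?_⟩
  · dsimp only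
    split_ifs with hy
    · exact div_pos hy (hpos _)
    · exact one_pos
  · filter_upwards [hformula (hf.toLp f), hqmp.ae hf.coeFn_toLp, hk] with y h1 h2 h3
    rw [if_pos h3]
    rw [h2, div_eq_iff h3.ne'] at h1
    rw [h1]
    ring

/-- Two maps under which the pullbacks of each `𝟙_A w` agree up to positive weights are equal almost
everywhere, because countably many sets `A` separate points. -/
theorem ae_eq_of_forall_indicator [StandardBorelSpace X₁] {w : X₁ → ℝ} (hpos : ∀ x, 0 < w x)
    {τ τ' : X₂ → X₁} {h h' : X₂ → ℝ} (hh : ∀ᵐ y ∂m₂, 0 < h y) (hh' : ∀ᵐ y ∂m₂, 0 < h' y)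
    (heq : ∀ A : Set X₁, MeasurableSet A → ∀ᵐ y ∂m₂,
      h y * A.indicator w (τ y) = h' y * A.indicator w (τ' y)) : τ =ᵐ[m₂] τ' := by
  refine EventuallyEq.of_forall_separating_mem_iff MeasurableSet fun A hA => ?_
  filter_upwards [heq A hA, hh, hh'] with y h1 h2 h3
  by_cases hy : τ y ∈ A <;> by_cases hy' : τ' y ∈ A <;> simp_all [(hpos _).ne']

theorem IsOrderIsomorphism.exists_isScalingTransformation
    [StandardBorelSpace X₁] [Nonempty X₁] [StandardBorelSpace X₂] [Nonempty X₂]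
    [SigmaFinite m₁] [SigmaFinite m₂] (hp0 : p ≠ 0) (hp : p ≠ ∞) (hU : IsOrderIsomorphism U) :
    ∃ (h : X₂ → ℝ) (τ : X₂ → X₁), IsScalingTransformation U h τ := by
  obtain ⟨h, τ, hm, hpos, hτ, hUf⟩ := hU.exists_weighted_composition hp0 hp
  obtain ⟨h', σ, hm', hpos', hσ, hUg⟩ := hU.symm.exists_weighted_composition hp0 hp
  refine ⟨h, τ, hm, hpos, hτ.measurable, ⟨σ, hσ.measurable, ?_, ?_⟩, hUf⟩
  · obtain ⟨w, hwm, hwpos, hw⟩ := exists_pos_memLp m₂ hp0 hp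
    refine ae_eq_of_forall_indicator hwpos (τ := σ ∘ τ) (τ' := id) (h := fun y => h y * h' (τ y))
      (h' := fun _ => 1) (Eventually.of_forall fun y => mul_pos (hpos y) (hpos' _))
      (Eventually.of_forall fun y => one_pos) fun A hA => ?_
    have h1 := hUg _ (hw.indicator hA)
    have h2 := hUf _ (Lp.memLp (U.symm ((hw.indicator hA).toLp _)))
    rw [Lp.toLp_coeFn, U.apply_symm_apply] at h2
    filter_upwards [hτ.ae h1, h2, (hw.indicator hA).coeFn_toLp] with y h1 h2 h3
    rw [h3, h1] at h2
    rw [one_mul, id, h2, mul_assoc, Function.comp_apply]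
  · obtain ⟨w, hwm, hwpos, hw⟩ := exists_pos_memLp m₁ hp0 hp
    refine ae_eq_of_forall_indicator hwpos (τ := τ ∘ σ) (τ' := id) (h := fun y => h' y * h (σ y))
      (h' := fun _ => 1) (Eventually.of_forall fun y => mul_pos (hpos' y) (hpos _))
      (Eventually.of_forall fun y => one_pos) fun A hA => ?_
    have h1 := hUf _ (hw.indicator hA)
    have h2 := hUg _ (Lp.memLp (U ((hw.indicator hA).toLp _)))
    rw [Lp.toLp_coeFn, U.symm_apply_apply] at h2
    filter_upwards [hσ.ae h1, h2, (hw.indicator hA).coeFn_toLp] with y h1 h2 h3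
    rw [h3, h1] at h2
    rw [one_mul, id, h2, mul_assoc, Function.comp_apply]

namespace IsScalingTransformation

variable {h h' : X₂ → ℝ} {τ τ' : X₂ → X₁}

/-- The transformation preserves null sets because `h · (f ∘ τ)` must not depend on the
representative `f`. -/
theorem quasiMeasurePreserving [SigmaFinite m₁] (hp0 : p ≠ 0) (hp : p ≠ ∞)
    (hS : IsScalingTransformation U h τ) : Measure.QuasiMeasurePreserving τ m₂ m₁ := by
  obtain ⟨w, hwm, hpos, hw⟩ := exists_pos_memLp m₁ hp0 hp
  refine ⟨hS.measurable_transformation, Measure.AbsolutelyContinuous.mk fun A hA hA0 => ?_⟩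
  rw [Measure.map_apply hS.measurable_transformation hA, measure_eq_zero_iff_ae_notMem]
  have h0 : (hw.indicator hA).toLp _ = 0 := by
    refine Lp.ext ?_
    filter_upwards [(hw.indicator hA).coeFn_toLp, Lp.coeFn_zero ℝ p m₁,
      measure_eq_zero_iff_ae_notMem.1 hA0] with x h1 h2 h3
    rw [h1, h2, Set.indicator_of_notMem h3, Pi.zero_apply]
  have h1 := hS.eq_comp _ (hw.indicator hA)
  rw [h0, map_zero] at h1
  filter_upwards [h1, Lp.coeFn_zero ℝ p m₂] with y h1 h2 hy
  rw [h2, Set.indicator_of_mem (by exact hy)] at h1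
  exact (mul_pos (hS.scaling_pos y) (hpos _)).ne h1

/-- The inverse of the transformation preserves null sets because `U` is injective. -/
theorem quasiMeasurePreserving_inverse [SigmaFinite m₁] (hp0 : p ≠ 0) (hp : p ≠ ∞)
    (hS : IsScalingTransformation U h τ) {σ : X₁ → X₂} (hσ : Measurable σ)
    (hστ : ∀ᵐ y ∂m₂, σ (τ y) = y) : Measure.QuasiMeasurePreserving σ m₁ m₂ := by
  obtain ⟨w, hwm, hpos, hw⟩ := exists_pos_memLp m₁ hp0 hp
  refine ⟨hσ, Measure.AbsolutelyContinuous.mk fun B hB hB0 => ?_⟩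
  rw [Measure.map_apply hσ hB, measure_eq_zero_iff_ae_notMem]
  have h1 := hS.eq_comp _ (hw.indicator (hσ hB))
  have h0 : U ((hw.indicator (hσ hB)).toLp _) = 0 := by
    refine Lp.ext ?_
    filter_upwards [h1, hστ, Lp.coeFn_zero ℝ p m₂, measure_eq_zero_iff_ae_notMem.1 hB0]
      with y h1 h2 h3 h4
    rw [h1, h3, Set.indicator_of_notMem (by rwa [Set.mem_preimage, h2]), mul_zero, Pi.zero_apply]
  rw [LinearEquiv.map_eq_zero_iff] at h0
  filter_upwards [(hw.indicator (hσ hB)).coeFn_toLp, Lp.coeFn_zero ℝ p m₁] with x h2 h3 hx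
  rw [h0, h3, Set.indicator_of_mem hx] at h2
  exact (hpos x).ne h2

/-- The scaling and the transformation of an operator are unique. -/
theorem ae_eq [SigmaFinite m₁] [StandardBorelSpace X₁] (hp0 : p ≠ 0) (hp : p ≠ ∞)
    (hS : IsScalingTransformation U h τ) (hS' : IsScalingTransformation U h' τ') :
    h =ᵐ[m₂] h' ∧ τ =ᵐ[m₂] τ' := by
  obtain ⟨w, hwm, hpos, hw⟩ := exists_pos_memLp m₁ hp0 hp
  have hτ : τ =ᵐ[m₂] τ' := ae_eq_of_forall_indicator hpos
    (Eventually.of_forall hS.scaling_pos) (Eventually.of_forall hS'.scaling_pos)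
    fun A hA => (hS.eq_comp _ (hw.indicator hA)).symm.trans (hS'.eq_comp _ (hw.indicator hA))
  refine ⟨?_, hτ⟩
  filter_upwards [hτ, (hS.eq_comp _ hw).symm.trans (hS'.eq_comp _ hw)] with y h1 h2
  rw [h1] at h2
  exact mul_right_cancel₀ (hpos _).ne' h2

end IsScalingTransformation
end Existence

/-! ### The intertwining relation forces the weight to be invariant -/

section Semigroups

variable {X₁ X₂ : Type*} [MeasurableSpace X₁] [MeasurableSpace X₂]
  {m₁ : Measure X₁} {m₂ : Measure X₂} [SigmaFinite m₁] [SigmaFinite m₂] {p : ℝ≥0∞}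
  {U : Lp ℝ p m₁ ≃ₗ[ℝ] Lp ℝ p m₂} {h : X₂ → ℝ} {τ : X₂ → X₁}
  {T₁ : ℝ≥0 → Lp ℝ 2 m₁ →L[ℝ] Lp ℝ 2 m₁} {T₂ : ℝ≥0 → Lp ℝ 2 m₂ →L[ℝ] Lp ℝ 2 m₂}

namespace IsScalingTransformation

/-- The measure `τ_#(h² m₂)` has a finite density, since the inverse of `τ` makes it σ-finite. -/
theorem exists_map_eq_withDensity (hp0 : p ≠ 0) (hp : p ≠ ∞)
    (hS : IsScalingTransformation U h τ) : ∃ φ : X₁ → ℝ≥0∞, Measurable φ ∧ (∀ᵐ x ∂m₁, φ x < ∞) ∧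
      (m₂.withDensity fun y => ENNReal.ofReal (h y ^ 2)).map τ = m₁.withDensity φ := by
  have hτ := hS.quasiMeasurePreserving hp0 hp
  obtain ⟨σ, hσ, hστ, hτσ⟩ := hS.ae_inverse
  set ν := m₂.withDensity fun y => ENNReal.ofReal (h y ^ 2) with hν
  have hνm : ν ≪ m₂ := withDensity_absolutelyContinuous _ _
  have hac : ν.map τ ≪ m₁ := (hνm.map hτ.measurable).trans hτ.absolutelyContinuous
  have : SigmaFinite ν := SigmaFinite.withDensity_ofReal _
  have : SigmaFinite (ν.map τ) := by
    refine ⟨⟨{ set := fun n => σ ⁻¹' spanningSets ν n, set_mem := fun _ => trivial,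
               finite := fun n => ?_, spanning := ?_ }⟩⟩
    · rw [Measure.map_apply hτ.measurable (hσ (measurableSet_spanningSets ν n))]
      refine lt_of_eq_of_lt (measure_congr ?_) (measure_spanningSets_lt_top ν n)
      refine eventuallyEq_set.2 ?_
      filter_upwards [hνm.ae_le hστ] with y hy
      simp only [Set.mem_preimage, hy]
    · rw [← Set.preimage_iUnion, iUnion_spanningSets, Set.preimage_univ]
  exact ⟨(ν.map τ).rnDeriv m₁, Measure.measurable_rnDeriv _ _, Measure.rnDeriv_lt_top _ _,
    (Measure.withDensity_rnDeriv_eq _ _ hac).symm⟩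

omit [SigmaFinite m₁] [SigmaFinite m₂] in
theorem lintegral_comp {μ : Measure X₁} (hS : IsScalingTransformation U h τ)
    (hμ : (m₂.withDensity fun y => ENNReal.ofReal (h y ^ 2)).map τ = μ)
    {F : X₁ → ℝ≥0∞} (hF : Measurable F) :
    ∫⁻ y, ENNReal.ofReal (h y ^ 2) * F (τ y) ∂m₂ = ∫⁻ x, F x ∂μ := by
  rw [← hμ, lintegral_map hF hS.measurable_transformation,
    lintegral_withDensity_eq_lintegral_mul _ (hS.measurable_scaling.pow_const 2).ennreal_ofReal
      (by exact hF.comp hS.measurable_transformation : Measurable fun y => F (τ y))]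
  rfl

omit [SigmaFinite m₁] [SigmaFinite m₂] in
theorem integral_comp {μ : Measure X₁} (hS : IsScalingTransformation U h τ)
    (hμ : (m₂.withDensity fun y => ENNReal.ofReal (h y ^ 2)).map τ = μ)
    {F : X₁ → ℝ} (hF : AEStronglyMeasurable F μ) :
    ∫ y, h y ^ 2 * F (τ y) ∂m₂ = ∫ x, F x ∂μ := by
  subst hμ
  rw [integral_map hS.measurable_transformation.aemeasurable hF,
    integral_withDensity_eq_integral_toReal_smul
      (hS.measurable_scaling.pow_const 2).ennreal_ofReal
      (Eventually.of_forall fun _ => ENNReal.ofReal_lt_top)]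
  simp_rw [ENNReal.toReal_ofReal (sq_nonneg _), smul_eq_mul]

omit [SigmaFinite m₁] [SigmaFinite m₂] in
theorem integrable_comp_iff {μ : Measure X₁} (hS : IsScalingTransformation U h τ)
    (hμ : (m₂.withDensity fun y => ENNReal.ofReal (h y ^ 2)).map τ = μ)
    {F : X₁ → ℝ} (hF : AEStronglyMeasurable F μ) :
    Integrable (fun y => h y ^ 2 * F (τ y)) m₂ ↔ Integrable F μ := by
  subst hμ
  rw [integrable_map_measure hF hS.measurable_transformation.aemeasurable,
    integrable_withDensity_iff_integrable_smul'
      (hS.measurable_scaling.pow_const 2).ennreal_ofReal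
      (Eventually.of_forall fun _ => ENNReal.ofReal_lt_top)]
  simp_rw [ENNReal.toReal_ofReal (sq_nonneg _), smul_eq_mul, Function.comp_apply]

variable [Fact (1 ≤ p)]

/-- On functions for which everything is square integrable, the operators on `L²` are themselves
intertwined by `f ↦ h · (f ∘ τ)`. -/
theorem apply_comp (hp : p ≠ ∞) (hT₁ : IsMarkovianSemigroup m₁ T₁)
    (hT₂ : IsMarkovianSemigroup m₂ T₂) (hUT : Intertwines U T₁ T₂)
    (hS : IsScalingTransformation U h τ) (t : ℝ≥0) {f : X₁ → ℝ} (hfp : MemLp f p m₁)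
    (hf : MemLp f 2 m₁) (hf' : MemLp (fun y => h y * f (τ y)) 2 m₂) :
    T₂ t (hf'.toLp _) =ᵐ[m₂] fun y => h y * T₁ t (hf.toLp f) (τ y) := by
  have hp0 : p ≠ 0 := (zero_lt_one.trans_le (Fact.out : 1 ≤ p)).ne'
  have hτ := hS.quasiMeasurePreserving hp0 hp
  have h1 := (hT₁.isInducedOn_inducedOp t p).agree (hf.toLp f) (hfp.toLp f)
    (hf.coeFn_toLp.trans hfp.coeFn_toLp.symm)
  have h2 := (hT₂.isInducedOn_inducedOp t p).agree (hf'.toLp _) (U (hfp.toLp f))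
    (hf'.coeFn_toLp.trans (hS.eq_comp f hfp).symm)
  have h3 := hS.eq_comp _ (Lp.memLp (inducedOp p (T₁ t) (hfp.toLp f)))
  rw [Lp.toLp_coeFn, hUT t] at h3
  filter_upwards [hτ.ae h1, h2, h3] with y h1 h2 h3
  rw [h2, h3, h1]

theorem integrable_mul_apply (hp : p ≠ ∞) (hT₁ : IsMarkovianSemigroup m₁ T₁)
    (hT₂ : IsMarkovianSemigroup m₂ T₂) (hUT : Intertwines U T₁ T₂)
    (hS : IsScalingTransformation U h τ) {φ : X₁ → ℝ≥0∞} (hφ : Measurable φ)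
    (hφ' : ∀ᵐ x ∂m₁, φ x < ∞)
    (hμ : (m₂.withDensity fun y => ENNReal.ofReal (h y ^ 2)).map τ = m₁.withDensity φ)
    (t : ℝ≥0) {f g : X₁ → ℝ} (hfp : MemLp f p m₁)
    (hf : MemLp f 2 m₁) (hf' : MemLp (fun y => h y * f (τ y)) 2 m₂)
    (hg : MemLp g 2 m₁) (hg' : MemLp (fun y => h y * g (τ y)) 2 m₂) :
    Integrable (fun x => (φ x).toReal * (g x * T₁ t (hf.toLp f) x)) m₁ ∧
    ∫ x, (φ x).toReal * (g x * T₁ t (hf.toLp f) x) ∂m₁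
      = inner ℝ (hg'.toLp _) (T₂ t (hf'.toLp _)) := by
  have hac : m₁.withDensity φ ≪ m₁ := withDensity_absolutelyContinuous _ _
  have hF : AEStronglyMeasurable (fun x => g x * T₁ t (hf.toLp f) x) (m₁.withDensity φ) :=
    (hg.1.mul (Lp.aestronglyMeasurable _)).mono_ac hac
  have hcongr : (fun y => h y ^ 2 * (g (τ y) * T₁ t (hf.toLp f) (τ y))) =ᵐ[m₂]
      fun y => inner ℝ (hg'.toLp _ y) (T₂ t (hf'.toLp _) y) := by
    filter_upwards [hg'.coeFn_toLp, hS.apply_comp hp hT₁ hT₂ hUT t hfp hf hf'] with y h1 h2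
    rw [h1, h2, RCLike.inner_apply, conj_trivial]
    ring
  constructor
  · have h1 := (L2.integrable_inner (𝕜 := ℝ) (hg'.toLp _) (T₂ t (hf'.toLp _))).congr hcongr.symm
    rw [hS.integrable_comp_iff hμ hF, integrable_withDensity_iff_integrable_smul' hφ hφ'] at h1
    exact h1
  · rw [L2.inner_def, ← integral_congr_ae hcongr, hS.integral_comp hμ hF,
      integral_withDensity_eq_integral_toReal_smul hφ hφ']
    rfl

/-- If `f` lives on `{φ ≤ c}` and `g` on `{φ > c}`, then `T f` vanishes where `g` does not: by the
symmetry `∫ (φ - c) g T f = ∫ (φ - c) f T g`, and the two sides have opposite signs. -/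
theorem apply_eq_zero_of_le (hp : p ≠ ∞) (hT₁ : IsMarkovianSemigroup m₁ T₁)
    (hT₂ : IsMarkovianSemigroup m₂ T₂) (hUT : Intertwines U T₁ T₂)
    (hS : IsScalingTransformation U h τ) {φ : X₁ → ℝ≥0∞} (hφ : Measurable φ)
    (hφ' : ∀ᵐ x ∂m₁, φ x < ∞)
    (hμ : (m₂.withDensity fun y => ENNReal.ofReal (h y ^ 2)).map τ = m₁.withDensity φ)
    (t : ℝ≥0) {f g : X₁ → ℝ} (hf0 : ∀ x, 0 ≤ f x) (hg0 : ∀ x, 0 ≤ g x) (hfp : MemLp f p m₁)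
    (hf : MemLp f 2 m₁) (hf' : MemLp (fun y => h y * f (τ y)) 2 m₂) (hgp : MemLp g p m₁)
    (hg : MemLp g 2 m₁) (hg' : MemLp (fun y => h y * g (τ y)) 2 m₂) {c : ℝ}
    (hfc : ∀ x, f x ≠ 0 → (φ x).toReal ≤ c) (hgc : ∀ x, g x ≠ 0 → c < (φ x).toReal) :
    ∀ᵐ x ∂m₁, g x ≠ 0 → T₁ t (hf.toLp f) x = 0 := by
  obtain ⟨hi₁, he₁⟩ := hS.integrable_mul_apply hp hT₁ hT₂ hUT hφ hφ' hμ t hfp hf hf' hg hg'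
  obtain ⟨hi₂, he₂⟩ := hS.integrable_mul_apply hp hT₁ hT₂ hUT hφ hφ' hμ t hgp hg hg' hf hf'
  have hfn : 0 ≤ hf.toLp f := by
    rw [← Lp.coeFn_nonneg]
    filter_upwards [hf.coeFn_toLp] with x hx
    rw [hx]; exact hf0 x
  have hgn : 0 ≤ hg.toLp g := by
    rw [← Lp.coeFn_nonneg]
    filter_upwards [hg.coeFn_toLp] with x hx
    rw [hx]; exact hg0 x
  have hj₁ : Integrable (fun x => g x * T₁ t (hf.toLp f) x) m₁ :=
    hg.integrable_mul (Lp.memLp (T₁ t (hf.toLp f)))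
  have hj₂ : Integrable (fun x => f x * T₁ t (hg.toLp g) x) m₁ :=
    hf.integrable_mul (Lp.memLp (T₁ t (hg.toLp g)))
  have hsymm : ∫ x, g x * T₁ t (hf.toLp f) x ∂m₁ = ∫ x, f x * T₁ t (hg.toLp g) x ∂m₁ := by
    have h1 := hT₁.symmetric t (hf.toLp f) (hg.toLp g)
    rw [L2.inner_def, L2.inner_def] at h1
    calc _ = ∫ x, inner ℝ (T₁ t (hf.toLp f) x) (hg.toLp g x) ∂m₁ := by
          refine integral_congr_ae ?_
          filter_upwards [hg.coeFn_toLp] with x hx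
          rw [hx, RCLike.inner_apply, conj_trivial]
      _ = _ := h1
      _ = _ := by
          refine integral_congr_ae ?_
          filter_upwards [hf.coeFn_toLp] with x hx
          rw [hx, RCLike.inner_apply, conj_trivial, mul_comm]
  have hsymm' : ∫ x, (φ x).toReal * (g x * T₁ t (hf.toLp f) x) ∂m₁
      = ∫ x, (φ x).toReal * (f x * T₁ t (hg.toLp g) x) ∂m₁ := by
    rw [he₁, he₂, ← hT₂.symmetric, real_inner_comm]
  have hle : ∫ x, ((φ x).toReal - c) * (f x * T₁ t (hg.toLp g) x) ∂m₁ ≤ 0 := by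
    refine integral_nonpos_of_ae ?_
    filter_upwards [hT₁.coeFn_nonneg t hgn] with x hx
    by_cases hx0 : f x = 0
    · simp [hx0]
    · exact mul_nonpos_of_nonpos_of_nonneg (sub_nonpos.2 (hfc x hx0)) (mul_nonneg (hf0 x) hx)
  have hnn : 0 ≤ᵐ[m₁] fun x => ((φ x).toReal - c) * (g x * T₁ t (hf.toLp f) x) := by
    filter_upwards [hT₁.coeFn_nonneg t hfn] with x hx
    by_cases hx0 : g x = 0
    · simp [hx0]
    · exact mul_nonneg (sub_nonneg.2 (hgc x hx0).le) (mul_nonneg (hg0 x) hx)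
  have hint : Integrable (fun x => ((φ x).toReal - c) * (g x * T₁ t (hf.toLp f) x)) m₁ := by
    simp_rw [sub_mul]
    exact hi₁.sub (hj₁.const_mul c)
  have heq : ∫ x, ((φ x).toReal - c) * (g x * T₁ t (hf.toLp f) x) ∂m₁
      = ∫ x, ((φ x).toReal - c) * (f x * T₁ t (hg.toLp g) x) ∂m₁ := by
    simp_rw [sub_mul]
    rw [integral_sub hi₁ (hj₁.const_mul c), integral_sub hi₂ (hj₂.const_mul c), hsymm',
      integral_const_mul, integral_const_mul, hsymm]
  have hzero := (integral_eq_zero_iff_of_nonneg_ae hnn hint).1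
    (le_antisymm (heq.trans_le hle) (integral_nonneg_of_ae hnn))
  filter_upwards [hzero] with x hx hx0
  have := sub_pos.2 (hgc x hx0)
  simpa [this.ne', hx0] using hx

omit [SigmaFinite m₁] [SigmaFinite m₂] [Fact (1 ≤ p)] in
theorem memLp_two_indicator (hS : IsScalingTransformation U h τ) {φ : X₁ → ℝ≥0∞}
    (hφ' : ∀ᵐ x ∂m₁, φ x < ∞)
    (hμ : (m₂.withDensity fun y => ENNReal.ofReal (h y ^ 2)).map τ = m₁.withDensity φ)
    {D : Set X₁} (hD : MeasurableSet D) (hfin : m₁ D ≠ ∞) (C : ℝ)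
    (hC : ∀ x ∈ D, (φ x).toReal ≤ C) :
    MemLp (fun y => h y * D.indicator (fun _ => (1 : ℝ)) (τ y)) 2 m₂ := by
  have hmeas : Measurable fun y => h y * D.indicator (fun _ => (1 : ℝ)) (τ y) :=
    hS.measurable_scaling.mul
      ((measurable_const.indicator hD).comp hS.measurable_transformation)
  refine ⟨hmeas.aestronglyMeasurable, ?_⟩
  rw [eLpNorm_lt_top_iff_lintegral_rpow_enorm_lt_top (by simp) (by simp)]
  calc ∫⁻ y, ‖h y * D.indicator (fun _ => (1 : ℝ)) (τ y)‖ₑ ^ (2 : ℝ≥0∞).toReal ∂m₂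
      = ∫⁻ y, ENNReal.ofReal (h y ^ 2) * D.indicator 1 (τ y) ∂m₂ := by
        refine lintegral_congr fun y => ?_
        by_cases hy : τ y ∈ D
        · rw [Set.indicator_of_mem hy, Set.indicator_of_mem hy, mul_one, Pi.one_apply, mul_one,
            Real.enorm_eq_ofReal (hS.scaling_pos y).le, ENNReal.toReal_ofNat, ENNReal.rpow_ofNat,
            ENNReal.ofReal_pow (hS.scaling_pos y).le]
        · simp [hy]
    _ = m₁.withDensity φ D := by
        rw [hS.lintegral_comp hμ (measurable_one.indicator hD), lintegral_indicator_one hD]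
    _ = ∫⁻ x in D, φ x ∂m₁ := withDensity_apply _ hD
    _ ≤ ∫⁻ x in D, ENNReal.ofReal C ∂m₁ := by
        refine setLIntegral_mono_ae' hD ?_
        filter_upwards [hφ'] with x hx hxD
        rw [← ENNReal.ofReal_toReal hx.ne]
        exact ENNReal.ofReal_le_ofReal (hC x hxD)
    _ < ∞ := by
        rw [setLIntegral_const]
        exact ENNReal.mul_lt_top ENNReal.ofReal_lt_top hfin.lt_top

/-- The sublevel sets of the density of `τ_#(h² m₂)` are invariant: truncations of `𝟙_A` and of
indicator functions of subsets of `Aᶜ` exhaust `A` and `Aᶜ` by functions to which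
`apply_eq_zero_of_le` applies. -/
theorem isInvariantSet (hp : p ≠ ∞) (hT₁ : IsMarkovianSemigroup m₁ T₁)
    (hT₂ : IsMarkovianSemigroup m₂ T₂) (hUT : Intertwines U T₁ T₂)
    (hS : IsScalingTransformation U h τ) {φ : X₁ → ℝ≥0∞} (hφ : Measurable φ)
    (hφ' : ∀ᵐ x ∂m₁, φ x < ∞)
    (hμ : (m₂.withDensity fun y => ENNReal.ofReal (h y ^ 2)).map τ = m₁.withDensity φ) (c : ℝ)
    (hA : MeasurableSet {x | (φ x).toReal ≤ c}) : IsInvariantSet T₁ hA := by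
  intro t
  set A := {x | (φ x).toReal ≤ c}
  have hfA : ∀ n, MeasurableSet (A ∩ spanningSets m₁ n) := fun n =>
    hA.inter (measurableSet_spanningSets m₁ n)
  have hffin : ∀ n, m₁ (A ∩ spanningSets m₁ n) ≠ ∞ := fun n =>
    measure_ne_top_of_subset Set.inter_subset_right (measure_spanningSets_lt_top m₁ n).ne
  have hf : ∀ n (r : ℝ≥0∞), MemLp ((A ∩ spanningSets m₁ n).indicator fun _ => (1 : ℝ)) r m₁ :=
    fun n r => memLp_indicator_const r (hfA n) 1 (Or.inr (hffin n))
  have hmono : ∀ n, T₁ t (trunc 2 m₁ (indClass m₁ hA) n) ≤ T₁ t ((hf n 2).toLp _) := fun n => by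
    refine hT₁.monotone t ?_
    rw [← Lp.coeFn_le]
    filter_upwards [(memLp_truncFun 2 m₁ (indClass m₁ hA) n).coeFn_toLp, (hf n 2).coeFn_toLp,
      AEEqFun.coeFn_mk (A.indicator (1 : X₁ → ℝ≥0∞))
        ((measurable_one.indicator hA).aestronglyMeasurable (μ := m₁))] with x h1 h2 h3
    rw [trunc, h1, h2, truncFun, Set.inter_comm, ← Set.indicator_indicator]
    refine Set.indicator_le_indicator ?_
    rw [indClass, h3]
    by_cases hx : x ∈ A
    · rw [Set.indicator_of_mem hx, Set.indicator_of_mem hx]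
      exact ENNReal.toReal_mono ENNReal.one_ne_top (min_le_left _ _)
    · rw [Set.indicator_of_notMem hx, Set.indicator_of_notMem hx]
      simp
  have hone : ∀ n, ∀ᵐ x ∂m₁, T₁ t ((hf n 2).toLp _) x ≤ 1 := fun n => by
    refine hT₁.apply_le_const t zero_le_one ?_
    filter_upwards [(hf n 2).coeFn_toLp] with x hx
    rw [hx]
    exact Set.indicator_le_self' (fun _ _ => zero_le_one) x
  have hzero : ∀ n, ∀ᵐ x ∂m₁, x ∉ A → T₁ t ((hf n 2).toLp _) x = 0 := fun n => by
    have hB : ∀ k : ℕ, MeasurableSet (({x | (φ x).toReal ≤ k} ∩ Aᶜ) ∩ spanningSets m₁ k) :=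
      fun k => ((measurableSet_le hφ.ennreal_toReal measurable_const).inter hA.compl).inter
        (measurableSet_spanningSets m₁ k)
    have hBfin : ∀ k : ℕ, m₁ (({x | (φ x).toReal ≤ k} ∩ Aᶜ) ∩ spanningSets m₁ k) ≠ ∞ := fun k =>
      measure_ne_top_of_subset Set.inter_subset_right (measure_spanningSets_lt_top m₁ k).ne
    have hg := fun (k : ℕ) (r : ℝ≥0∞) =>
      memLp_indicator_const (μ := m₁) r (hB k) (1 : ℝ) (Or.inr (hBfin k))
    have key := fun k : ℕ => hS.apply_eq_zero_of_le hp hT₁ hT₂ hUT hφ hφ' hμ t (c := c)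
      (fun x => Set.indicator_nonneg (fun _ _ => zero_le_one) x)
      (fun x => Set.indicator_nonneg (fun _ _ => zero_le_one) x)
      (hf n p) (hf n 2) (hS.memLp_two_indicator hφ' hμ (hfA n) (hffin n) c fun x hx => hx.1)
      (hg k p) (hg k 2) (hS.memLp_two_indicator hφ' hμ (hB k) (hBfin k) k fun x hx => hx.1.1)
      (fun x hx => (Set.mem_of_indicator_ne_zero hx).1)
      (fun x hx => not_le.1 (Set.mem_of_indicator_ne_zero hx).1.2)
    filter_upwards [ae_all_iff.2 key] with x hx hxA
    obtain ⟨k, hk1, hk2⟩ := ((eventually_mem_spanningSets m₁ x).and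
      ((tendsto_natCast_atTop_atTop (R := ℝ)).eventually_ge_atTop (φ x).toReal)).exists
    refine hx k ?_
    have hxB : x ∈ ({x | (φ x).toReal ≤ k} ∩ Aᶜ) ∩ spanningSets m₁ k := ⟨⟨hk2, hxA⟩, hk1⟩
    rw [Set.indicator_of_mem hxB]
    exact one_ne_zero
  rw [← AEEqFun.coeFn_le]
  filter_upwards [ae_all_iff.2 fun n => (Lp.coeFn_le _ _).2 (hmono n), ae_all_iff.2 hone,
    ae_all_iff.2 hzero, AEEqFun.coeFn_mk (A.indicator (1 : X₁ → ℝ≥0∞))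
        ((measurable_one.indicator hA).aestronglyMeasurable (μ := m₁)),
    AEEqFun.coeFn_mk _ (AEMeasurable.iSup fun n => (Lp.aestronglyMeasurable
      (T₁ t (trunc 2 m₁ (indClass m₁ hA) n))).aemeasurable.ennreal_ofReal).aestronglyMeasurable]
    with x h1 h2 h3 h4 h5
  rw [posExt, h5, indClass, h4]
  refine iSup_le fun n => ?_
  refine (ENNReal.ofReal_le_ofReal (h1 n)).trans ?_
  by_cases hx : x ∈ A
  · rw [Set.indicator_of_mem hx]
    simpa using h2 n
  · rw [h3 n hx]
    simp

end IsScalingTransformation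

theorem ae_eq_const_of_forall_le {m : Measure X₁} {φ : X₁ → ℝ}
    (h : ∀ c : ℝ, m {x | φ x ≤ c} = 0 ∨ m {x | φ x ≤ c}ᶜ = 0) : ∃ b, φ =ᵐ[m] fun _ => b := by
  have : HasCountableSeparatingOn ℝ (fun s => ∃ c, s = Set.Iic c) Set.univ := by
    refine ⟨Set.range fun q : ℚ => Set.Iic (q : ℝ), Set.countable_range _, ?_, ?_⟩
    · rintro _ ⟨q, rfl⟩
      exact ⟨q, rfl⟩
    · intro x _ y _ hxy
      by_contra hne
      rcases lt_or_gt_of_ne hne with hlt | hlt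
      · obtain ⟨q, h1, h2⟩ := exists_rat_btwn hlt
        exact absurd ((hxy _ ⟨q, rfl⟩).1 h1.le) (not_le.2 h2)
      · obtain ⟨q, h1, h2⟩ := exists_rat_btwn hlt
        exact absurd ((hxy _ ⟨q, rfl⟩).2 h1.le) (not_le.2 h2)
  refine exists_eventuallyEq_const_of_forall_separating (l := ae m) (f := φ)
    (fun s => ∃ c, s = Set.Iic c) ?_
  rintro _ ⟨c, rfl⟩
  rcases h c with h | h
  · exact Or.inr (measure_eq_zero_iff_ae_notMem.1 h)
  · exact Or.inl h

/-- By irreducibility the density of `τ_#(h² m₂)` is constant. The constant vanishes only if both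
measures are zero; then every `β` is admissible. -/
theorem IsScalingTransformation.exists_map_eq_smul [Fact (1 ≤ p)] (hp : p ≠ ∞)
    (hT₁ : IsMarkovianSemigroup m₁ T₁) (hT₂ : IsMarkovianSemigroup m₂ T₂)
    (hirr : IsIrreducible T₁) (hUT : Intertwines U T₁ T₂)
    (hS : IsScalingTransformation U h τ) : ∃ β : ℝ, 0 < β ∧
      (m₂.withDensity fun y => ENNReal.ofReal (h y ^ 2)).map τ = ENNReal.ofReal β • m₁ := by
  have hp0 : p ≠ 0 := (zero_lt_one.trans_le (Fact.out : 1 ≤ p)).ne'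
  obtain ⟨φ, hφ, hφ', hμ⟩ := hS.exists_map_eq_withDensity hp0 hp
  rcases eq_or_ne m₁ 0 with h0 | h0
  · refine ⟨1, one_pos, ?_⟩
    rw [hμ, h0]
    simp
  obtain ⟨b, hb⟩ := ae_eq_const_of_forall_le (m := m₁) (φ := fun x => (φ x).toReal) fun c =>
    hirr _ _ (hS.isInvariantSet hp hT₁ hT₂ hUT hφ hφ' hμ c
      (measurableSet_le hφ.ennreal_toReal measurable_const))
  have hbφ : φ =ᵐ[m₁] fun _ => ENNReal.ofReal b := by
    filter_upwards [hb, hφ'] with x hx hx'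
    rw [← hx, ENNReal.ofReal_toReal hx'.ne]
  have hμ' := hμ.trans ((withDensity_congr_ae hbφ).trans (withDensity_const _))
  refine ⟨b, ?_, hμ'⟩
  by_contra! hneg
  refine h0 ?_
  rw [ENNReal.ofReal_of_nonpos hneg, zero_smul,
    Measure.map_eq_zero_iff hS.measurable_transformation.aemeasurable,
    withDensity_eq_zero_iff (hS.measurable_scaling.pow_const 2).ennreal_ofReal.aemeasurable] at hμ'
  obtain ⟨σ, hσ, hστ, -⟩ := hS.ae_inverse
  have hm₂ : m₂ = 0 := by
    rw [← ae_eq_bot, ← eventually_false_iff_eq_bot]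
    filter_upwards [hμ'] with y hy
    exact absurd (ENNReal.ofReal_eq_zero.1 hy) (not_le.2 (pow_pos (hS.scaling_pos y) 2))
  have hac := (hS.quasiMeasurePreserving_inverse hp0 hp hσ hστ).absolutelyContinuous
  rw [hm₂, Measure.absolutelyContinuous_zero_iff, Measure.map_eq_zero_iff hσ.aemeasurable] at hac
  exact hac

end Semigroups

/-! ### Extensions of weighted compositions to `[0, ∞]`-valued functions -/

section Extension

variable {X Y : Type*} [MeasurableSpace X] [MeasurableSpace Y] {m : Measure X} [SigmaFinite m]
  {m' : Measure Y} {p : ℝ≥0∞}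

theorem iSup_ofReal_truncFun (f : X →ₘ[m] ℝ≥0∞) (x : X) :
    ⨆ n, ENNReal.ofReal (truncFun m f n x) = f x := by
  have hval : ∀ n : ℕ, ENNReal.ofReal (min (f x) n).toReal = min (f x) n := fun n =>
    ENNReal.ofReal_toReal (ne_top_of_le_ne_top (ENNReal.natCast_ne_top n) (min_le_right _ _))
  refine le_antisymm (iSup_le fun n => ?_) ?_
  · by_cases hx : x ∈ spanningSets m n
    · rw [truncFun, Set.indicator_of_mem hx, hval]
      exact min_le_left _ _
    · rw [truncFun, Set.indicator_of_notMem hx, ENNReal.ofReal_zero]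
      exact zero_le
  · have h1 : Tendsto (fun n : ℕ => min (f x) n) atTop (𝓝 (f x)) := by
      have := (tendsto_const_nhds (x := f x)).min ENNReal.tendsto_nat_nhds_top
      rwa [min_eq_left le_top] at this
    refine le_of_tendsto h1 ?_
    filter_upwards [eventually_mem_spanningSets m x] with n hn
    refine le_trans (le_of_eq ?_) (le_iSup _ n)
    rw [truncFun, Set.indicator_of_mem hn, hval]

theorem posExt_ae_eq {S : Lp ℝ p m → Lp ℝ p m'} {κ : Y → ℝ} {θ : Y → X} (hκ : ∀ y, 0 ≤ κ y)
    (hS : ∀ (f : X → ℝ) (hf : MemLp f p m), S (hf.toLp f) =ᵐ[m'] fun y => κ y * f (θ y))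
    (f : X →ₘ[m] ℝ≥0∞) : posExt S f =ᵐ[m'] fun y => ENNReal.ofReal (κ y) * f (θ y) := by
  filter_upwards [AEEqFun.coeFn_mk _ (AEMeasurable.iSup fun n => (Lp.aestronglyMeasurable
      (S (trunc p m f n))).aemeasurable.ennreal_ofReal).aestronglyMeasurable,
    ae_all_iff.2 fun n => hS _ (memLp_truncFun p m f n)] with y h1 h2
  rw [posExt, h1, ← iSup_ofReal_truncFun f (θ y), ENNReal.mul_iSup]
  refine iSup_congr fun n => ?_
  rw [trunc, h2, ENNReal.ofReal_mul (hκ y)]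

end Extension

/-! ### Transport of weighted compositions to other exponents -/

theorem le_rpow_of_rpow_le {x s C : ℝ} (hx : 0 < x) (hs : s ≠ 0) (h1 : x ^ s ≤ C)
    (h2 : x ^ (-s) ≤ C) : x ≤ C ^ (1 / |s|) ∧ x⁻¹ ≤ C ^ (1 / |s|) := by
  have hs' : 0 < |s| := abs_pos.2 hs
  have key : ∀ z : ℝ, 0 < z → z ^ |s| ≤ C → z ≤ C ^ (1 / |s|) := fun z hz hzC => by
    have := Real.rpow_le_rpow (Real.rpow_nonneg hz.le _) hzC (one_div_nonneg.2 hs'.le)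
    rwa [← Real.rpow_mul hz.le, mul_one_div_cancel hs'.ne', Real.rpow_one] at this
  have h3 : x ^ |s| ≤ C ∧ x ^ (-|s|) ≤ C := by
    rcases abs_choice s with h | h <;> rw [h]
    · exact ⟨h1, h2⟩
    · rw [neg_neg]
      exact ⟨h2, h1⟩
  refine ⟨key x hx h3.1, key _ (inv_pos.2 hx) ?_⟩
  rw [Real.inv_rpow hx.le, ← Real.rpow_neg hx.le]
  exact h3.2

section Transport

variable {X₁ X₂ : Type*} [MeasurableSpace X₁] [MeasurableSpace X₂]
  {m₁ : Measure X₁} {m₂ : Measure X₂} {p : ℝ≥0∞}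
  {U : Lp ℝ p m₁ ≃ₗ[ℝ] Lp ℝ p m₂} {h : X₂ → ℝ} {τ : X₂ → X₁} {σ : X₁ → X₂} {β : ℝ}

namespace IsScalingTransformation

theorem symm (hS : IsScalingTransformation U h τ) (hτ : Measure.QuasiMeasurePreserving τ m₂ m₁)
    (hσ : Measure.QuasiMeasurePreserving σ m₁ m₂) (hστ : ∀ᵐ y ∂m₂, σ (τ y) = y)
    (hτσ : ∀ᵐ x ∂m₁, τ (σ x) = x) :
    IsScalingTransformation U.symm (fun x => (h (σ x))⁻¹) σ where
  measurable_scaling := (hS.measurable_scaling.comp hσ.measurable).inv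
  scaling_pos x := inv_pos.2 (hS.scaling_pos _)
  measurable_transformation := hσ.measurable
  ae_inverse := ⟨τ, hτ.measurable, hτσ, hστ⟩
  eq_comp g hg := by
    have h1 := hS.eq_comp _ (Lp.memLp (U.symm (hg.toLp g)))
    rw [Lp.toLp_coeFn, U.apply_symm_apply] at h1
    filter_upwards [hσ.ae h1, hσ.ae hg.coeFn_toLp, hτσ] with x h2 h3 h4
    rw [← h3, h2, h4, inv_mul_cancel_left₀ (hS.scaling_pos _).ne']

/-- The inverse operator satisfies the same transformation rule, with the constant `1 / β`. -/
theorem map_symm (hS : IsScalingTransformation U h τ) (hσ : Measurable σ)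
    (hστ : ∀ᵐ y ∂m₂, σ (τ y) = y) (hβ : 0 < β)
    (hμ : (m₂.withDensity fun y => ENNReal.ofReal (h y ^ 2)).map τ = ENNReal.ofReal β • m₁) :
    (m₁.withDensity fun x => ENNReal.ofReal (((h (σ x))⁻¹) ^ 2)).map σ
      = ENNReal.ofReal β⁻¹ • m₂ := by
  have hw : Measurable fun x => ENNReal.ofReal (((h (σ x))⁻¹) ^ 2) :=
    ((hS.measurable_scaling.comp hσ).inv.pow_const 2).ennreal_ofReal
  ext D hD
  rw [Measure.map_apply hσ hD, withDensity_apply _ (hσ hD), ← lintegral_indicator (hσ hD),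
    Measure.smul_apply, smul_eq_mul]
  have h1 := hS.lintegral_comp hμ (hw.indicator (hσ hD))
  have h2 : ∫⁻ y, ENNReal.ofReal (h y ^ 2) * (σ ⁻¹' D).indicator
      (fun x => ENNReal.ofReal (((h (σ x))⁻¹) ^ 2)) (τ y) ∂m₂ = m₂ D := by
    rw [← lintegral_indicator_one hD]
    refine lintegral_congr_ae ?_
    filter_upwards [hστ] with y hy
    by_cases hyD : y ∈ D
    · rw [Set.indicator_of_mem (by rwa [Set.mem_preimage, hy]), Set.indicator_of_mem hyD, hy,
        ← ENNReal.ofReal_mul (sq_nonneg _), ← mul_pow, mul_inv_cancel₀ (hS.scaling_pos y).ne']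
      simp
    · rw [Set.indicator_of_notMem (by rwa [Set.mem_preimage, hy]), Set.indicator_of_notMem hyD,
        mul_zero]
  rw [← h2, h1, lintegral_smul_measure, smul_eq_mul, ← mul_assoc,
    ← ENNReal.ofReal_mul (inv_nonneg.2 hβ.le), inv_mul_cancel₀ hβ.ne', ENNReal.ofReal_one, one_mul]

/-- The boundedness of `U` bounds `∫ h ^ p` over any set by a multiple of `∫ h ^ 2`. -/
theorem exists_rpow_le [SigmaFinite m₂] [Fact (1 ≤ p)] (hp : p ≠ ∞) (hU : IsOrderIsomorphism U)
    (hS : IsScalingTransformation U h τ) (hσ : Measurable σ)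
    (hστ : ∀ᵐ y ∂m₂, σ (τ y) = y) (hβ : 0 < β)
    (hμ : (m₂.withDensity fun y => ENNReal.ofReal (h y ^ 2)).map τ = ENNReal.ofReal β • m₁) :
    ∃ C : ℝ, ∀ᵐ y ∂m₂, h y ^ (p.toReal - 2) ≤ C := by
  have hp0 : p ≠ 0 := (zero_lt_one.trans_le (Fact.out : 1 ≤ p)).ne'
  obtain ⟨C, hC0, hC⟩ := hU.exists_norm_le
  set K : ℝ := C ^ p.toReal * β⁻¹ with hK
  have hK0 : 0 ≤ K := by positivity
  have key : ∀ᵐ y ∂m₂, ENNReal.ofReal (h y ^ p.toReal) ≤ ENNReal.ofReal (K * h y ^ 2) := by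
    refine ae_le_of_forall_setLIntegral_le_of_sigmaFinite
      (hS.measurable_scaling.pow_const _).ennreal_ofReal fun D hD _ => ?_
    set B := σ ⁻¹' D
    have hB : MeasurableSet B := hσ hD
    have hBD : ∀ᵐ y ∂m₂, (τ y ∈ B ↔ y ∈ D) := by
      filter_upwards [hστ] with y hy
      rw [Set.mem_preimage, hy]
    have hval : ∫⁻ y in D, ENNReal.ofReal (K * h y ^ 2) ∂m₂
        = ENNReal.ofReal C ^ p.toReal * m₁ B := by
      have h1 := hS.lintegral_comp hμ (measurable_one.indicator hB)
      rw [lintegral_indicator_one hB, Measure.smul_apply, smul_eq_mul] at h1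
      have h2 : ∫⁻ y in D, ENNReal.ofReal (h y ^ 2) ∂m₂ = ENNReal.ofReal β * m₁ B := by
        rw [← h1, ← lintegral_indicator hD]
        refine lintegral_congr_ae ?_
        filter_upwards [hBD] with y hy
        by_cases hyD : y ∈ D
        · rw [Set.indicator_of_mem hyD, Set.indicator_of_mem (hy.2 hyD), Pi.one_apply, mul_one]
        · rw [Set.indicator_of_notMem hyD, Set.indicator_of_notMem (mt hy.1 hyD), mul_zero]
      simp_rw [ENNReal.ofReal_mul hK0]
      rw [lintegral_const_mul _ (hS.measurable_scaling.pow_const 2).ennreal_ofReal, h2, ← mul_assoc,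
        ← ENNReal.ofReal_mul hK0, hK, inv_mul_cancel_right₀ hβ.ne',
        ENNReal.ofReal_rpow_of_nonneg hC0.le ENNReal.toReal_nonneg]
    rw [hval]
    -- If `m₁ B = ∞`, then `𝟙_B` is not in `L^p`, but the right-hand side is infinite.
    by_cases hfin : m₁ B = ∞
    · rw [hfin, ENNReal.mul_top]
      · exact le_top
      · have := ENNReal.rpow_pos (p := p.toReal) (ENNReal.ofReal_pos.2 hC0) ENNReal.ofReal_ne_top
        exact this.ne'
    have hf := memLp_indicator_const (μ := m₁) p hB (1 : ℝ) (Or.inr hfin)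
    have h1 : eLpNorm (U (hf.toLp _)) p m₂ ≤ ENNReal.ofReal C * eLpNorm (hf.toLp _) p m₁ := by
      have h2 := hC (hf.toLp _)
      rw [Lp.norm_def, Lp.norm_def] at h2
      have h3 := ENNReal.ofReal_le_ofReal h2
      rwa [ENNReal.ofReal_mul hC0.le, ENNReal.ofReal_toReal (Lp.eLpNorm_ne_top _),
        ENNReal.ofReal_toReal (Lp.eLpNorm_ne_top _)] at h3
    rw [eLpNorm_congr_ae hf.coeFn_toLp, eLpNorm_congr_ae (hS.eq_comp _ hf),
      eLpNorm_indicator_const hB hp0 hp, eLpNorm_eq_lintegral_rpow_enorm_toReal hp0 hp] at h1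
    have hpp := ENNReal.toReal_pos hp0 hp
    have h4 := ENNReal.rpow_le_rpow h1 hpp.le
    rw [← ENNReal.rpow_mul, one_div_mul_cancel hpp.ne', ENNReal.rpow_one,
      ENNReal.mul_rpow_of_nonneg _ _ hpp.le, enorm_one, one_mul, ← ENNReal.rpow_mul,
      one_div_mul_cancel hpp.ne', ENNReal.rpow_one] at h4
    refine le_trans (le_of_eq ?_) h4
    rw [← lintegral_indicator hD]
    refine lintegral_congr_ae ?_
    filter_upwards [hBD] with y hy
    by_cases hyD : y ∈ D
    · rw [Set.indicator_of_mem hyD, Set.indicator_of_mem (hy.2 hyD), mul_one,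
        Real.enorm_eq_ofReal (hS.scaling_pos y).le,
        ENNReal.ofReal_rpow_of_nonneg (hS.scaling_pos y).le hpp.le]
    · rw [Set.indicator_of_notMem hyD, Set.indicator_of_notMem (mt hy.1 hyD)]
      simp [hpp]
  refine ⟨K, ?_⟩
  filter_upwards [key] with y hy
  have hh := hS.scaling_pos y
  rw [ENNReal.ofReal_le_ofReal_iff (mul_nonneg hK0 (sq_nonneg _))] at hy
  rw [Real.rpow_sub hh, Real.rpow_two]
  exact (div_le_iff₀ (pow_pos hh 2)).2 hy

/-- For `p ≠ 2`, bounds on `h ^ (p - 2)` and, by passing to the inverse, on `h ^ (2 - p)` make `h`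
and `1 / h` essentially bounded. -/
theorem exists_bound [SigmaFinite m₁] [SigmaFinite m₂] [Fact (1 ≤ p)] (hp : p ≠ ∞) (hp2 : p ≠ 2)
    (hU : IsOrderIsomorphism U) (hS : IsScalingTransformation U h τ) (hβ : 0 < β)
    (hμ : (m₂.withDensity fun y => ENNReal.ofReal (h y ^ 2)).map τ = ENNReal.ofReal β • m₁) :
    ∃ C : ℝ, ∀ᵐ y ∂m₂, h y ≤ C ∧ (h y)⁻¹ ≤ C := by
  have hp0 : p ≠ 0 := (zero_lt_one.trans_le (Fact.out : 1 ≤ p)).ne'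
  obtain ⟨σ, hσ, hστ, hτσ⟩ := hS.ae_inverse
  have hτq := hS.quasiMeasurePreserving hp0 hp
  have hσq := hS.quasiMeasurePreserving_inverse hp0 hp hσ hστ
  obtain ⟨C₁, hC₁⟩ := hS.exists_rpow_le hp hU hσ hστ hβ hμ
  obtain ⟨C₂, hC₂⟩ := (hS.symm hτq hσq hστ hτσ).exists_rpow_le hp hU.symm hτq.measurable hτσ
    (inv_pos.2 hβ) (hS.map_symm hσ hστ hβ hμ)
  have hs : p.toReal - 2 ≠ 0 := by
    rw [sub_ne_zero]
    intro h2
    exact hp2 (by rw [← ENNReal.ofReal_toReal hp, h2]; simp)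
  refine ⟨(max C₁ C₂) ^ (1 / |p.toReal - 2|), ?_⟩
  filter_upwards [hC₁, hτq.ae hC₂, hστ] with y h1 h2 h3
  rw [h3, Real.inv_rpow (hS.scaling_pos y).le, ← Real.rpow_neg (hS.scaling_pos y).le] at h2
  exact le_rpow_of_rpow_le (hS.scaling_pos y) hs (h1.trans (le_max_left _ _))
    (h2.trans (le_max_right _ _))

theorem memLp_comp (hS : IsScalingTransformation U h τ)
    (hμ : (m₂.withDensity fun y => ENNReal.ofReal (h y ^ 2)).map τ = ENNReal.ofReal β • m₁)
    {C : ℝ} (hC : ∀ᵐ y ∂m₂, h y ≤ C ∧ (h y)⁻¹ ≤ C) {r : ℝ≥0∞} {f : X₁ → ℝ} (hf : MemLp f r m₁) :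
    MemLp (fun y => h y * f (τ y)) r m₂ := by
  have hle : m₂ ≤ ENNReal.ofReal (C ^ 2) • m₂.withDensity fun y => ENNReal.ofReal (h y ^ 2) := by
    have hm := (hS.measurable_scaling.pow_const 2).ennreal_ofReal
    rw [← withDensity_smul _ hm]
    conv_lhs => rw [← withDensity_one (μ := m₂)]
    refine withDensity_mono ?_
    filter_upwards [hC] with y hy
    have h0 := hS.scaling_pos y
    rw [Pi.one_apply, Pi.smul_apply, smul_eq_mul, ← ENNReal.ofReal_mul (sq_nonneg _), ← mul_pow,
      ← ENNReal.ofReal_one]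
    refine ENNReal.ofReal_le_ofReal (one_le_pow₀ ?_)
    have := mul_le_mul_of_nonneg_right hy.2 h0.le
    rwa [inv_mul_cancel₀ h0.ne'] at this
  have hle' : m₂.map τ ≤ (ENNReal.ofReal (C ^ 2) * ENNReal.ofReal β) • m₁ := by
    rw [mul_smul, ← hμ, ← Measure.map_smul]
    exact Measure.map_mono hle hS.measurable_transformation
  have h1 : MemLp f r (m₂.map τ) := hf.of_measure_le_smul
    (ENNReal.mul_ne_top ENNReal.ofReal_ne_top ENNReal.ofReal_ne_top) hle'
  have h2 := h1.comp_of_map hS.measurable_transformation.aemeasurable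
  refine h2.of_le_mul (c := C) (hS.measurable_scaling.aestronglyMeasurable.mul h2.1) ?_
  filter_upwards [hC] with y hy
  rw [norm_mul, Real.norm_of_nonneg (hS.scaling_pos y).le]
  exact mul_le_mul_of_nonneg_right hy.1 (norm_nonneg _)

/-- If `h` and `1 / h` are essentially bounded, then `f ↦ h · (f ∘ τ)` is invertible on `L^r`. -/
theorem exists_linearEquiv [SigmaFinite m₁] (hp0 : p ≠ 0) (hp : p ≠ ∞)
    (hS : IsScalingTransformation U h τ) (hβ : 0 < β)
    (hμ : (m₂.withDensity fun y => ENNReal.ofReal (h y ^ 2)).map τ = ENNReal.ofReal β • m₁)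
    {C : ℝ} (hC : ∀ᵐ y ∂m₂, h y ≤ C ∧ (h y)⁻¹ ≤ C) (r : ℝ≥0∞) :
    ∃ Ur : Lp ℝ r m₁ ≃ₗ[ℝ] Lp ℝ r m₂, IsScalingTransformation Ur h τ := by
  obtain ⟨σ, hσ, hστ, hτσ⟩ := hS.ae_inverse
  have hτq := hS.quasiMeasurePreserving hp0 hp
  have hσq := hS.quasiMeasurePreserving_inverse hp0 hp hσ hστ
  have hC' : ∀ᵐ x ∂m₁, (h (σ x))⁻¹ ≤ C ∧ ((h (σ x))⁻¹)⁻¹ ≤ C := by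
    filter_upwards [hσq.ae hC] with x hx
    rw [inv_inv]
    exact hx.symm
  have hmem : ∀ f : Lp ℝ r m₁, MemLp (fun y => h y * f (τ y)) r m₂ := fun f =>
    hS.memLp_comp hμ hC (Lp.memLp f)
  have hmem' : ∀ g : Lp ℝ r m₂, MemLp (fun x => (h (σ x))⁻¹ * g (σ x)) r m₁ := fun g =>
    (hS.symm hτq hσq hστ hτσ).memLp_comp (hS.map_symm hσ hστ hβ hμ) hC' (Lp.memLp g)
  let Ur : Lp ℝ r m₁ ≃ₗ[ℝ] Lp ℝ r m₂ :=
    { toFun := fun f => (hmem f).toLp _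
      invFun := fun g => (hmem' g).toLp _
      map_add' := fun f g => by
        rw [← MemLp.toLp_add]
        refine MemLp.toLp_congr _ _ ?_
        filter_upwards [hτq.ae (Lp.coeFn_add f g)] with y hy
        rw [hy, Pi.add_apply, mul_add]
        rfl
      map_smul' := fun c f => by
        rw [RingHom.id_apply, ← MemLp.toLp_const_smul]
        refine MemLp.toLp_congr _ _ ?_
        filter_upwards [hτq.ae (Lp.coeFn_smul c f)] with y hy
        rw [hy, Pi.smul_apply, Pi.smul_apply, smul_eq_mul, smul_eq_mul]
        ring
      left_inv := fun f => by
        refine Lp.ext ((hmem' _).coeFn_toLp.trans ?_)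
        filter_upwards [hσq.ae (hmem f).coeFn_toLp, hτσ] with x h1 h2
        rw [h1, h2, inv_mul_cancel_left₀ (hS.scaling_pos _).ne']
      right_inv := fun g => by
        refine Lp.ext ((hmem _).coeFn_toLp.trans ?_)
        filter_upwards [hτq.ae (hmem' g).coeFn_toLp, hστ] with y h1 h2
        rw [h1, h2, mul_inv_cancel_left₀ (hS.scaling_pos _).ne'] }
  refine ⟨Ur, hS.measurable_scaling, hS.scaling_pos, hS.measurable_transformation,
    hS.ae_inverse, fun f hf => ?_⟩
  refine (hmem (hf.toLp f)).coeFn_toLp.trans ?_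
  filter_upwards [hτq.ae hf.coeFn_toLp] with y hy
  rw [hy]

theorem isOrderIsomorphism (hS : IsScalingTransformation U h τ)
    (hτ : Measure.QuasiMeasurePreserving τ m₂ m₁) (hσ : Measure.QuasiMeasurePreserving σ m₁ m₂)
    (hστ : ∀ᵐ y ∂m₂, σ (τ y) = y) (hτσ : ∀ᵐ x ∂m₁, τ (σ x) = x) : IsOrderIsomorphism U where
  positive f hf := by
    rw [← Lp.coeFn_nonneg] at hf ⊢
    have h1 := hS.eq_comp _ (Lp.memLp f)
    rw [Lp.toLp_coeFn] at h1
    filter_upwards [h1, hτ.ae hf] with y h2 h3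
    rw [h2]
    exact mul_nonneg (hS.scaling_pos y).le h3
  positive_symm g hg := by
    have hS' := hS.symm hτ hσ hστ hτσ
    rw [← Lp.coeFn_nonneg] at hg ⊢
    have h1 := hS'.eq_comp _ (Lp.memLp g)
    rw [Lp.toLp_coeFn] at h1
    filter_upwards [h1, hσ.ae hg] with x h2 h3
    rw [h2]
    exact mul_nonneg (hS'.scaling_pos x).le h3

end IsScalingTransformation
end Transport

/-! ### The intertwining relation on the other `L^r`-spaces -/

section IntertwiningTransport

variable {X₁ X₂ : Type*} [MeasurableSpace X₁] [MeasurableSpace X₂]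
  {m₁ : Measure X₁} {m₂ : Measure X₂} [SigmaFinite m₁] [SigmaFinite m₂] {p r : ℝ≥0∞}
  [Fact (1 ≤ p)] [Fact (1 ≤ r)]
  {U : Lp ℝ p m₁ ≃ₗ[ℝ] Lp ℝ p m₂} {Ur : Lp ℝ r m₁ ≃ₗ[ℝ] Lp ℝ r m₂} {h : X₂ → ℝ} {τ : X₂ → X₁}
  {T₁ : ℝ≥0 → Lp ℝ 2 m₁ →L[ℝ] Lp ℝ 2 m₁} {T₂ : ℝ≥0 → Lp ℝ 2 m₂ →L[ℝ] Lp ℝ 2 m₂} {β C : ℝ}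

/-- For `r < ∞` it suffices to check the intertwining relation on the dense set of functions that
belong to every `L^s`, where all induced operators agree with the operator on `L²`. -/
theorem intertwines_of_ne_top (hp : p ≠ ∞) (hr : r ≠ ∞) (hT₁ : IsMarkovianSemigroup m₁ T₁)
    (hT₂ : IsMarkovianSemigroup m₂ T₂) (hUT : Intertwines U T₁ T₂)
    (hS : IsScalingTransformation U h τ) (hSr : IsScalingTransformation Ur h τ)
    (hUr : IsOrderIsomorphism Ur)
    (hμ : (m₂.withDensity fun y => ENNReal.ofReal (h y ^ 2)).map τ = ENNReal.ofReal β • m₁)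
    (hC : ∀ᵐ y ∂m₂, h y ≤ C ∧ (h y)⁻¹ ≤ C) : Intertwines Ur T₁ T₂ := by
  have hp0 : p ≠ 0 := (zero_lt_one.trans_le (Fact.out : 1 ≤ p)).ne'
  have hτ := hS.quasiMeasurePreserving hp0 hp
  intro t
  refine congr_fun (Continuous.ext_on (dense_setOf_forall_memLp hr)
    (hUr.continuous.comp (inducedOp r (T₁ t)).continuous)
    ((inducedOp r (T₂ t)).continuous.comp hUr.continuous) fun f hf => Lp.ext ?_)
  have hf' : MemLp (fun y => h y * f (τ y)) 2 m₂ := hS.memLp_comp hμ hC (hf 2)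
  have h1 := (hT₁.isInducedOn_inducedOp t r).agree _ f (hf 2).coeFn_toLp
  have h0 := hSr.eq_comp _ (Lp.memLp f)
  rw [Lp.toLp_coeFn] at h0
  have h2 := (hT₂.isInducedOn_inducedOp t r).agree (hf'.toLp _) (Ur f)
    (hf'.coeFn_toLp.trans h0.symm)
  have h3 := hSr.eq_comp _ (Lp.memLp (inducedOp r (T₁ t) f))
  rw [Lp.toLp_coeFn] at h3
  filter_upwards [hτ.ae h1, h2, h3, hS.apply_comp hp hT₁ hT₂ hUT t (hf p) (hf 2) hf']
    with y h1 h2 h3 h4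
  rw [← h2, h3, h4, h1]

/-- On `L^∞` the intertwining relation is tested against indicator functions of sets of finite
measure, where it reduces by duality to the relation on `L²`. -/
theorem intertwines_top {Ui : Lp ℝ ∞ m₁ ≃ₗ[ℝ] Lp ℝ ∞ m₂} (hp : p ≠ ∞)
    (hT₁ : IsMarkovianSemigroup m₁ T₁)
    (hT₂ : IsMarkovianSemigroup m₂ T₂) (hUT : Intertwines U T₁ T₂)
    (hS : IsScalingTransformation U h τ) (hSi : IsScalingTransformation Ui h τ) (hβ : 0 < β)
    (hμ : (m₂.withDensity fun y => ENNReal.ofReal (h y ^ 2)).map τ = ENNReal.ofReal β • m₁)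
    (hC : ∀ᵐ y ∂m₂, h y ≤ C ∧ (h y)⁻¹ ≤ C) : Intertwines Ui T₁ T₂ := by
  have hp0 : p ≠ 0 := (zero_lt_one.trans_le (Fact.out : 1 ≤ p)).ne'
  obtain ⟨σ, hσ, hστ, hτσ⟩ := hS.ae_inverse
  have hτq := hS.quasiMeasurePreserving hp0 hp
  have hσq := hS.quasiMeasurePreserving_inverse hp0 hp hσ hστ
  have hac : ENNReal.ofReal β • m₁ ≪ m₁ := Measure.smul_absolutelyContinuous
  have hC' : ∀ᵐ x ∂m₁, (h (σ x))⁻¹ ≤ C ∧ ((h (σ x))⁻¹)⁻¹ ≤ C := by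
    filter_upwards [hσq.ae hC] with x hx
    rw [inv_inv]
    exact hx.symm
  intro t f
  have hint : ∀ (g : Lp ℝ ∞ m₂) (D : Set X₂), m₂ D < ∞ → IntegrableOn g D m₂ := fun g D hD =>
    integrableOn_Lp_of_measure_ne_top g le_top hD.ne
  refine Lp.ext (ae_eq_of_forall_setIntegral_eq_of_sigmaFinite (fun D _ hD => hint _ D hD)
    (fun D _ hD => hint _ D hD) fun D hD hfin => ?_)
  have hg : ∀ s, MemLp (D.indicator fun _ => (1 : ℝ)) s m₂ := fun s =>
    memLp_indicator_const s hD 1 (Or.inr hfin.ne)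
  have hg' : ∀ s, MemLp (fun x => (h (σ x))⁻¹ * D.indicator (fun _ => (1 : ℝ)) (σ x)) s m₁ :=
    fun s => (hS.symm hτq hσq hστ hτσ).memLp_comp (hS.map_symm hσ hστ hβ hμ) hC' (hg s)
  set g' : X₁ → ℝ := fun x => (h (σ x))⁻¹ * D.indicator (fun _ => (1 : ℝ)) (σ x) with hg'def
  have hgg' : (fun y => h y * g' (τ y)) =ᵐ[m₂] D.indicator fun _ => (1 : ℝ) := by
    filter_upwards [hστ] with y hy
    rw [hg'def]
    simp only [hy]
    rw [mul_inv_cancel_left₀ (hS.scaling_pos y).ne']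
  have hg'' : MemLp (fun y => h y * g' (τ y)) 2 m₂ := (hg 2).ae_eq hgg'.symm
  have happ := hS.apply_comp hp hT₁ hT₂ hUT t (hg' p) (hg' 2) hg''
  have hadj₁ := (hT₁.isInducedOn_inducedOp t ∞).adjoint rfl f ((hg' 2).toLp g')
    ((hg' 1).ae_eq (hg' 2).coeFn_toLp.symm)
  have hadj₂ := (hT₂.isInducedOn_inducedOp t ∞).adjoint rfl (Ui f) (hg''.toLp _)
    (((hg 1).ae_eq hgg'.symm).ae_eq hg''.coeFn_toLp.symm)
  have hset : ∀ u : X₂ → ℝ, ∫ y in D, u y ∂m₂ = ∫ y, u y * (h y * g' (τ y)) ∂m₂ := fun u => by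
    rw [← integral_indicator hD]
    refine integral_congr_ae ?_
    filter_upwards [hgg'] with y hy
    rw [hy]
    by_cases hyD : y ∈ D <;> simp [hyD]
  have e₁ := hSi.eq_comp _ (Lp.memLp (inducedOp ∞ (T₁ t) f))
  have e₂ := hSi.eq_comp _ (Lp.memLp f)
  rw [Lp.toLp_coeFn] at e₁ e₂
  calc ∫ y in D, Ui (inducedOp ∞ (T₁ t) f) y ∂m₂
      = ∫ y, h y ^ 2 * (inducedOp ∞ (T₁ t) f (τ y) * g' (τ y)) ∂m₂ := by
        rw [hset]
        refine integral_congr_ae ?_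
        filter_upwards [e₁] with y hy
        rw [hy]
        ring
    _ = β * ∫ x, inducedOp ∞ (T₁ t) f x * g' x ∂m₁ := by
        rw [hS.integral_comp hμ (F := fun x => inducedOp ∞ (T₁ t) f x * g' x)
          (((Lp.aestronglyMeasurable _).mul (hg' 2).1).mono_ac hac), integral_smul_measure,
          ENNReal.toReal_ofReal hβ.le, smul_eq_mul]
    _ = β * ∫ x, f x * T₁ t ((hg' 2).toLp g') x ∂m₁ := by
        rw [← hadj₁]
        congr 1
        refine integral_congr_ae ?_
        filter_upwards [(hg' 2).coeFn_toLp] with x hx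
        rw [hx]
    _ = ∫ y, h y ^ 2 * (f (τ y) * T₁ t ((hg' 2).toLp g') (τ y)) ∂m₂ := by
        rw [hS.integral_comp hμ (F := fun x => f x * T₁ t ((hg' 2).toLp g') x)
          (((Lp.aestronglyMeasurable _).mul (Lp.aestronglyMeasurable _)).mono_ac hac),
          integral_smul_measure, ENNReal.toReal_ofReal hβ.le, smul_eq_mul]
    _ = ∫ y, Ui f y * T₂ t (hg''.toLp _) y ∂m₂ := by
        refine integral_congr_ae ?_
        filter_upwards [e₂, happ] with y h1 h2
        rw [h1, h2]
        ring
    _ = ∫ y in D, inducedOp ∞ (T₂ t) (Ui f) y ∂m₂ := by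
        rw [← hadj₂, hset]
        refine integral_congr_ae ?_
        filter_upwards [hg''.coeFn_toLp] with y hy
        rw [hy]

end IntertwiningTransport

/-! ### The adjoint -/

section Adjoint

variable {X₁ X₂ : Type*} [MeasurableSpace X₁] [MeasurableSpace X₂]
  {m₁ : Measure X₁} {m₂ : Measure X₂} [SigmaFinite m₁] [SigmaFinite m₂] {p q : ℝ≥0∞}
  {U : Lp ℝ p m₁ ≃ₗ[ℝ] Lp ℝ p m₂} {h : X₂ → ℝ} {τ : X₂ → X₁} {β : ℝ}

/-- The adjoint of a weighted composition is `β` times the inverse of the weighted composition with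
the same data on the dual space. -/
theorem exists_isLpAdjoint [Fact (1 ≤ q)] (hp0 : p ≠ 0) (hp : p ≠ ∞)
    (hS : IsScalingTransformation U h τ) (hβ : 0 < β)
    (hμ : (m₂.withDensity fun y => ENNReal.ofReal (h y ^ 2)).map τ = ENNReal.ofReal β • m₁)
    {Uq : Lp ℝ q m₁ ≃ₗ[ℝ] Lp ℝ q m₂} (hSq : IsScalingTransformation Uq h τ) :
    ∃ V : Lp ℝ q m₂ →L[ℝ] Lp ℝ q m₁, IsLpAdjoint U V ∧
      (∀ g : X₂ →ₘ[m₂] ℝ≥0∞, posExt U (posExt V g) =ᵐ[m₂] fun y => ENNReal.ofReal β * g y) ∧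
      (∀ f : X₁ →ₘ[m₁] ℝ≥0∞, posExt V (posExt U f) =ᵐ[m₁] fun x => ENNReal.ofReal β * f x) := by
  obtain ⟨σ, hσ, hστ, hτσ⟩ := hS.ae_inverse
  have hτq := hS.quasiMeasurePreserving hp0 hp
  have hσq := hS.quasiMeasurePreserving_inverse hp0 hp hσ hστ
  have hSq' := hSq.symm hτq hσq hστ hτσ
  have hUq := hSq.isOrderIsomorphism hτq hσq hστ hτσ
  let V : Lp ℝ q m₂ →L[ℝ] Lp ℝ q m₁ := β • ⟨Uq.symm.toLinearMap, hUq.symm.continuous⟩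
  have hV : ∀ (g : X₂ → ℝ) (hg : MemLp g q m₂),
      V (hg.toLp g) =ᵐ[m₁] fun x => β * (h (σ x))⁻¹ * g (σ x) := fun g hg => by
    change β • Uq.symm (hg.toLp g) =ᵐ[m₁] _
    filter_upwards [Lp.coeFn_smul β (Uq.symm (hg.toLp g)), hSq'.eq_comp g hg] with x h1 h2
    rw [h1, Pi.smul_apply, h2, smul_eq_mul, mul_assoc]
  have hVpos : ∀ x, 0 ≤ β * (h (σ x))⁻¹ := fun x =>
    mul_nonneg hβ.le (inv_nonneg.2 (hS.scaling_pos _).le)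
  have hweight : ∀ y, ENNReal.ofReal (β * (h y)⁻¹) * ENNReal.ofReal (h y) = ENNReal.ofReal β :=
    fun y => by
      rw [← ENNReal.ofReal_mul (mul_nonneg hβ.le (inv_nonneg.2 (hS.scaling_pos _).le)),
        inv_mul_cancel_right₀ (hS.scaling_pos y).ne']
  have eU := fun f : X₁ →ₘ[m₁] ℝ≥0∞ => posExt_ae_eq (fun y => (hS.scaling_pos y).le) hS.eq_comp f
  have eV := fun g : X₂ →ₘ[m₂] ℝ≥0∞ => posExt_ae_eq hVpos hV g
  refine ⟨V, fun f g => ?_, fun g => ?_, fun f => ?_⟩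
  · have e₁ := hS.eq_comp _ (Lp.memLp f)
    have e₂ := hV _ (Lp.memLp g)
    rw [Lp.toLp_coeFn] at e₁ e₂
    have hac : ENNReal.ofReal β • m₁ ≪ m₁ := Measure.smul_absolutelyContinuous
    have hmeas : AEStronglyMeasurable (fun x => f x * ((h (σ x))⁻¹ * g (σ x))) m₁ :=
      (Lp.aestronglyMeasurable f).mul
        ((hS.measurable_scaling.comp hσ).inv.aestronglyMeasurable.mul
          ((Lp.aestronglyMeasurable g).comp_quasiMeasurePreserving hσq))
    calc ∫ y, U f y * g y ∂m₂
        = ∫ y, h y ^ 2 * (f (τ y) * ((h (σ (τ y)))⁻¹ * g (σ (τ y)))) ∂m₂ := by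
          refine integral_congr_ae ?_
          filter_upwards [e₁, hστ] with y h1 h2
          have h3 := (hS.scaling_pos y).ne'
          rw [h1, h2]
          field_simp
      _ = β * ∫ x, f x * ((h (σ x))⁻¹ * g (σ x)) ∂m₁ := by
          rw [hS.integral_comp hμ (hmeas.mono_ac hac), integral_smul_measure,
            ENNReal.toReal_ofReal hβ.le, smul_eq_mul]
      _ = ∫ x, f x * V g x ∂m₁ := by
          rw [← integral_const_mul]
          refine integral_congr_ae ?_
          filter_upwards [e₂] with x hx
          rw [hx]
          ring
  · filter_upwards [eU (posExt V g), hτq.ae (eV g), hστ] with y h1 h2 h3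
    rw [h1, h2, h3, ← mul_assoc, mul_comm (ENNReal.ofReal (h y)), hweight]
  · filter_upwards [eV (posExt U f), hσq.ae (eU f), hτσ] with x h1 h2 h3
    rw [h1, h2, h3, ← mul_assoc, hweight]

theorem eq_two_of_holderConjugate_two (hpq : (2 : ℝ≥0∞).HolderConjugate q) : q = 2 := by
  have h1 := hpq.inv_add_inv_eq_one
  rw [← ENNReal.inv_two_add_inv_two, ENNReal.add_right_inj (by simp)] at h1
  exact inv_injective h1

end Adjoint
end OrderIntertwining

theorem theorem2p5 {X₁ X₂ : Type*}
    [MeasurableSpace X₁] [StandardBorelSpace X₁] [Nonempty X₁]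
    [MeasurableSpace X₂] [StandardBorelSpace X₂] [Nonempty X₂]
    (m₁ : Measure X₁) [SigmaFinite m₁] (m₂ : Measure X₂) [SigmaFinite m₂]
    (T₁ : ℝ≥0 → Lp ℝ 2 m₁ →L[ℝ] Lp ℝ 2 m₁) (T₂ : ℝ≥0 → Lp ℝ 2 m₂ →L[ℝ] Lp ℝ 2 m₂)
    (hT₁ : OrderIntertwining.IsMarkovianSemigroup m₁ T₁)
    (hT₂ : OrderIntertwining.IsMarkovianSemigroup m₂ T₂)
    (hirr₁ : OrderIntertwining.IsIrreducible T₁) (hirr₂ : OrderIntertwining.IsIrreducible T₂)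
    (p q : ℝ≥0∞) [Fact (1 ≤ p)] [Fact (1 ≤ q)] (hp : p ≠ ∞) (hpq : p.HolderConjugate q)
    (U : Lp ℝ p m₁ ≃ₗ[ℝ] Lp ℝ p m₂) (hU : OrderIntertwining.IsOrderIsomorphism U)
    (hUT : OrderIntertwining.Intertwines U T₁ T₂) :
    ∃ β : ℝ, 0 < β ∧
      (∃ V : Lp ℝ q m₂ →L[ℝ] Lp ℝ q m₁, OrderIntertwining.IsLpAdjoint U V ∧
        (∀ g : X₂ →ₘ[m₂] ℝ≥0∞, OrderIntertwining.posExt U (OrderIntertwining.posExt V g)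
          =ᵐ[m₂] fun y => ENNReal.ofReal β * g y) ∧
        (∀ f : X₁ →ₘ[m₁] ℝ≥0∞, OrderIntertwining.posExt V (OrderIntertwining.posExt U f)
          =ᵐ[m₁] fun x => ENNReal.ofReal β * f x)) ∧
      (∃ (h : X₂ → ℝ) (τ : X₂ → X₁), OrderIntertwining.IsScalingTransformation U h τ) ∧
      ∀ (h : X₂ → ℝ) (τ : X₂ → X₁), OrderIntertwining.IsScalingTransformation U h τ →
        (m₂.withDensity fun y => ENNReal.ofReal (h y ^ 2)).map τ = ENNReal.ofReal β • m₁ ∧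
        (p ≠ 2 →
          (∃ C : ℝ, ∀ᵐ y ∂m₂, h y ≤ C ∧ (h y)⁻¹ ≤ C) ∧
          ∀ (r : ℝ≥0∞) [Fact (1 ≤ r)], ∃ Ur : Lp ℝ r m₁ ≃ₗ[ℝ] Lp ℝ r m₂,
            (∀ (f : Lp ℝ p m₁) (g : Lp ℝ r m₁), f =ᵐ[m₁] g → U f =ᵐ[m₂] Ur g) ∧
            OrderIntertwining.IsOrderIsomorphism Ur ∧
            OrderIntertwining.Intertwines Ur T₁ T₂ ∧
            OrderIntertwining.IsScalingTransformation Ur h τ) := by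
  have hp1 : 1 ≤ p := Fact.out
  have hp0 : p ≠ 0 := (zero_lt_one.trans_le hp1).ne'
  obtain ⟨h₀, τ₀, hS₀⟩ := hU.exists_isScalingTransformation hp0 hp
  obtain ⟨β, hβ, hμ₀⟩ := hS₀.exists_map_eq_smul hp hT₁ hT₂ hirr₁ hUT
  refine ⟨β, hβ, ?_, ⟨h₀, τ₀, hS₀⟩, fun h τ hS => ?_⟩
  · have hUq : ∃ Uq : Lp ℝ q m₁ ≃ₗ[ℝ] Lp ℝ q m₂,
        OrderIntertwining.IsScalingTransformation Uq h₀ τ₀ := by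
      rcases eq_or_ne p 2 with rfl | hp2
      · obtain rfl := OrderIntertwining.eq_two_of_holderConjugate_two hpq
        exact ⟨U, hS₀⟩
      · obtain ⟨C, hC⟩ := hS₀.exists_bound hp hp2 hU hβ hμ₀
        exact hS₀.exists_linearEquiv hp0 hp hβ hμ₀ hC q
    obtain ⟨Uq, hSq⟩ := hUq
    exact OrderIntertwining.exists_isLpAdjoint hp0 hp hS₀ hβ hμ₀ hSq
  · obtain ⟨hh, hτ⟩ := hS.ae_eq hp0 hp hS₀
    have hμ : (m₂.withDensity fun y => ENNReal.ofReal (h y ^ 2)).map τ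
        = ENNReal.ofReal β • m₁ := by
      rw [← hμ₀]
      have hd : m₂.withDensity (fun y => ENNReal.ofReal (h y ^ 2))
          = m₂.withDensity fun y => ENNReal.ofReal (h₀ y ^ 2) :=
        withDensity_congr_ae (by filter_upwards [hh] with y hy; rw [hy])
      rw [hd]
      exact Measure.map_congr ((withDensity_absolutelyContinuous _ _).ae_eq hτ)
    refine ⟨hμ, fun hp2 => ?_⟩
    obtain ⟨C, hC⟩ := hS.exists_bound hp hp2 hU hβ hμ
    refine ⟨⟨C, hC⟩, fun r _ => ?_⟩
    obtain ⟨Ur, hSr⟩ := hS.exists_linearEquiv hp0 hp hβ hμ hC r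
    obtain ⟨σ, hσ, hστ, hτσ⟩ := hS.ae_inverse
    have hτq := hS.quasiMeasurePreserving hp0 hp
    have hσq := hS.quasiMeasurePreserving_inverse hp0 hp hσ hστ
    have hUr := hSr.isOrderIsomorphism hτq hσq hστ hτσ
    refine ⟨Ur, fun f g hfg => ?_, hUr, ?_, hSr⟩
    · have e₁ := hS.eq_comp _ (Lp.memLp f)
      have e₂ := hSr.eq_comp _ (Lp.memLp g)
      rw [Lp.toLp_coeFn] at e₁ e₂
      filter_upwards [e₁, e₂, hτq.ae hfg] with y h1 h2 h3
      rw [h1, h2, h3]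
    · rcases eq_or_ne r ∞ with rfl | hr
      · exact OrderIntertwining.intertwines_top hp hT₁ hT₂ hUT hS hSr hβ hμ hC
      · exact OrderIntertwining.intertwines_of_ne_top hp hr hT₁ hT₂ hUT hS hSr hUr hμ hC
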